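/- Let $d\ge 1$ and $N\ge 1$. A color set $\mathfrak c\subset\{1,\dots,d\}$ is called admissible if $|\mathfrak c|<d/2$, or $|\mathfrak c|=d/2$ and $1\in\mathfrak c$. Let $\mathfrak c_1,\dots,\mathfrak c_N$ be pairwise distinct, non-empty admissible color sets, and let $n_1,\dots,n_N\ge 0$ be integers, not all zero. The quartic bubble $Q(\mathfrak c)$ is the bipartite graph with white vertices $w_1,w_2$ and black vertices $b_1,b_2$, with edges of the colors in $\mathfrak c$ joining $w_1$ to $b_2$ and $w_2$ to $b_1$, and edges of the colors in $\{1,\dots,d\}\setminus\mathfrak c$ joining $w_1$ to $b_1$ and $w_2$ to $b_2$. Let $\mathcal G=\mathcal G_{n_1,\dots,n_N}(Q(\mathfrak c_1),\dots,Q(\mathfrak c_N))$ be the set of isomorphism classes of connected bipartite multigraphs, rooted at a white vertex, with edges colored by $\{0,\dots,d\}$ so that every vertex is incident to exactly one edge of each color, and such that deleting the edges of color $0$ leaves exactly $n_i$ copies of $Q(\mathfrak c_i)$ for each $i$. For $G\in\mathcal G$ let $C_{0a}(G)$ be the number of bicolored cycles with colors $\{0,a\}$, and $C_0(G)=\sum_{a=1}^d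 C_{0a}(G)$. Let $\mathcal M=\mathcal M_{n_1,\dots,n_N}(\mathfrak c_1,\dots,\mathfrak c_N)$ be the set of isomorphism classes of connected oriented maps (of any genus), rooted at a half-edge, with $n_i$ edges labeled by $\mathfrak c_i$ for each $i$ and no other edges. For $\mathfrak m\in\mathcal M$, let $\mathfrak m_a$ be the submap with all the vertices of $\mathfrak m$ and the edges whose label contains the color $a$, let $F(\mathfrak m_a)$ be its number of faces, summed over its connected components (an isolated vertex has one face), and let $\mathfrak m(\mathfrak c_i)$ be the submap of the edges labeled exactly $\mathfrak c_i$. Let $J:\mathcal G\to\mathcal M$ be the following map. In each bubble $Q(\mathfrak c_i)$ of $G$, every white vertex and the black vertex joined to it by the colors not in $\mathfrak c_i$ are merged into a half-edge, and the two half-edges of the bubble form an edge with label $\mathfrak c_i$. Each cycle alternating between such pairs and edges of color $0$ becomes a vertex, around which the half-edges are cyclically ordered by following the edges of color $0$ from black to white. The root vertex of $G$ becomes the root half-edge. Then: 1. $J$ is a bijection, and $C_{0a}(G)=F(J(G)_a)$ for all $G\in\mathcal G$ and $a\in\{1,\dots,d\}$. 2. The maximal number of bicolored cycles grows linearly: $$\max_{G\in\mathcal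 G}C_0(G)=d+\sum_{i=1}^N(d-|\mathfrak c_i|)\,n_i .$$ 3. Let $\mathcal G^{\max}$ be the set of $G\in\mathcal G$ which attain this maximum. Then $J(\mathcal G^{\max})$ is the set of the maps $\mathfrak m\in\mathcal M$ which maximize $\sum_{a=1}^dF(\mathfrak m_a)$, and it is exactly the set of the maps $\mathfrak m\in\mathcal M$ such that - $\mathfrak m$ is planar; - every edge whose label $\mathfrak c$ satisfies $|\mathfrak c|<d/2$ is a bridge; - for $i\ne j$, the submaps $\mathfrak m(\mathfrak c_i)$ and $\mathfrak m(\mathfrak c_j)$ meet only at cut-vertices which separate them: if a vertex $v$ is incident to an edge $e$ of $\mathfrak m(\mathfrak c_i)$ and to an edge $f$ of $\mathfrak m(\mathfrak c_j)$, then one cannot go from $e$ to $f$ in $\mathfrak m$ without passing through $v$. -/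

import Mathlib

namespace QuarticGluing

/-! ## Cycles of a permutation -/

/-- The number of cycles of a permutation, fixed points included. -/
noncomputable def numCycles {X : Type} (f : Equiv.Perm X) : ℕ :=
  Nat.card (Quotient (Equiv.Perm.SameCycle.setoid f))

theorem numCycles_congr {X Y : Type} (e : X ≃ Y) (f : Equiv.Perm X) (g : Equiv.Perm Y)
    (h : ∀ x, e (f x) = g (e x)) : numCycles f = numCycles g := by
  have hg : g = e.permCongrHom f := by
    ext y
    obtain ⟨x, rfl⟩ := e.surjective y
    simp [h]
  have hz : ∀ (i : ℤ) x, (g ^ i) (e x) = e ((f ^ i) x) := by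
    intro i x
    rw [hg, ← map_zpow]
    simp
  refine Nat.card_congr (Quotient.congr e ?_)
  intro x y
  change (∃ i : ℤ, (f ^ i) x = y) ↔ (∃ i : ℤ, (g ^ i) (e x) = e y)
  simp [hz]

/-! ## Colored graphs -/

/-- A bipartite properly edge-colored multigraph with color set `C`, white vertices `W` and black
vertices `B`: every vertex is incident to exactly one edge of every color, so the edges of color
`c` are a bijection from the white to the black vertices. -/
structure ColoredGraph (C W B : Type) where
  edge : C → W ≃ B

namespace ColoredGraph

/-- Isomorphism of colored graphs; it preserves the colors of the edges and of the vertices. -/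
structure Iso {C W B W' B' : Type} (G : ColoredGraph C W B) (G' : ColoredGraph C W' B') where
  white : W ≃ W'
  black : B ≃ B'
  comm : ∀ c w, black (G.edge c w) = G'.edge c (white w)

/-- The underlying simple graph, on all vertices. -/
def underlying {C W B : Type} (G : ColoredGraph C W B) : SimpleGraph (W ⊕ B) :=
  SimpleGraph.fromRel fun u v => ∃ c w, u = Sum.inl w ∧ v = Sum.inr (G.edge c w)

/-- Disjoint union of a family of colored graphs. -/
def disjointUnion {C ι : Type} {W B : ι → Type} (H : ∀ i, ColoredGraph C (W i) (B i)) :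
    ColoredGraph C (Σ i, W i) (Σ i, B i) where
  edge c := Equiv.sigmaCongrRight fun i => (H i).edge c

/-- In a graph with the `d + 1` colors `0, ..., d`, remove the edges of color `0`. The color
`a + 1` of the graph becomes the element `a` of `Fin d`. -/
def removeZero {d : ℕ} {W B : Type} (G : ColoredGraph (Fin (d + 1)) W B) :
    ColoredGraph (Fin d) W B where
  edge a := G.edge a.succ

/-- The number of bicolored cycles with the colors `0` and `a + 1`: going along the edge of color
`a + 1` from white to black, then along the edge of color `0` from black to white, is a permutation
of the white vertices whose cycles are the bicolored cycles. -/
noncomputable def bicoloredCycles {d : ℕ} {W B : Type} (G : ColoredGraph (Fin (d + 1)) W B)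
    (a : Fin d) : ℕ :=
  numCycles ((G.edge a.succ).trans (G.edge 0).symm)

theorem bicoloredCycles_iso {d : ℕ} {W B W' B' : Type} {G : ColoredGraph (Fin (d + 1)) W B}
    {G' : ColoredGraph (Fin (d + 1)) W' B'} (φ : Iso G G') (a : Fin d) :
    G.bicoloredCycles a = G'.bicoloredCycles a := by
  refine numCycles_congr φ.white _ _ fun w => ?_
  change φ.white ((G.edge 0).symm (G.edge a.succ w)) =
    (G'.edge 0).symm (G'.edge a.succ (φ.white w))
  rw [Equiv.eq_symm_apply, ← φ.comm, ← φ.comm, Equiv.apply_symm_apply]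

end ColoredGraph

/-! ## Quartic bubbles and their gluings -/

/-- The quartic bubble `Q(𝔠)`: two white and two black vertices; the white vertex `s` is joined to
the black vertex `!s` by the edges with colors in `𝔠`, and to the black vertex `s` by those with
colors not in `𝔠`. The colors `1, ..., d` are indexed by `Fin d`. -/
def quartic {d : ℕ} (𝔠 : Finset (Fin d)) : ColoredGraph (Fin d) Bool Bool where
  edge a := if a ∈ 𝔠 then Equiv.boolNot else Equiv.refl Bool

/-- Since `Q(𝔠)` and `Q([1..d] ∖ 𝔠)` are isomorphic, one of the two color sets is retained:
`|𝔠| < d / 2`, or `|𝔠| = d / 2` and `𝔠` contains the first color. -/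
def Admissible {d : ℕ} (𝔠 : Finset (Fin d)) : Prop :=
  2 * 𝔠.card < d ∨ (2 * 𝔠.card = d ∧ ∃ a ∈ 𝔠, a.val = 0)

/-- `G` is connected and removing its edges of color `0` leaves exactly `n i` copies of
`Q(c i)` for every `i`. -/
def IsGluing {d N : ℕ} (c : Fin N → Finset (Fin d)) (n : Fin N → ℕ) {W B : Type}
    (G : ColoredGraph (Fin (d + 1)) W B) : Prop :=
  G.underlying.Connected ∧
    Nonempty (G.removeZero.Iso
      (ColoredGraph.disjointUnion fun p : (Σ i : Fin N, Fin (n i)) => quartic (c p.1)))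

/-- The number of white vertices (and of black vertices) of a gluing of `n i` quartic bubbles of
type `i`. -/
abbrev size {N : ℕ} (n : Fin N → ℕ) : ℕ := 2 * ∑ i, n i

/-- Labeled representatives of rooted gluings. The root is a marked white vertex. -/
structure LabeledGluing {d N : ℕ} (c : Fin N → Finset (Fin d)) (n : Fin N → ℕ) where
  graph : ColoredGraph (Fin (d + 1)) (Fin (size n)) (Fin (size n))
  root : Fin (size n)
  isGluing : IsGluing c n graph

/-- Isomorphism of rooted gluings. -/
instance gluingSetoid {d N : ℕ} (c : Fin N → Finset (Fin d)) (n : Fin N → ℕ) :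
    Setoid (LabeledGluing c n) where
  r g g' := ∃ φ : g.graph.Iso g'.graph, φ.white g.root = g'.root
  iseqv :=
    { refl := fun g => ⟨⟨Equiv.refl _, Equiv.refl _, fun _ _ => rfl⟩, rfl⟩
      symm := by
        rintro g g' ⟨φ, h⟩
        refine ⟨⟨φ.white.symm, φ.black.symm, fun a w => ?_⟩, ?_⟩
        · rw [Equiv.symm_apply_eq, φ.comm, Equiv.apply_symm_apply]
        · exact (Equiv.symm_apply_eq _).2 h.symm
      trans := by
        rintro g g' g'' ⟨φ, h⟩ ⟨ψ, h'⟩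
        refine ⟨⟨φ.white.trans ψ.white, φ.black.trans ψ.black, fun a w => ?_⟩, ?_⟩
        · simp [φ.comm, ψ.comm]
        · simp [h, h'] }

/-- The set of connected rooted colored graphs built from `n i` copies of `Q(c i)`. -/
abbrev Gluing {d N : ℕ} (c : Fin N → Finset (Fin d)) (n : Fin N → ℕ) : Type :=
  Quotient (gluingSetoid c n)

/-- The number of bicolored cycles with colors `0` and `a + 1`. -/
noncomputable def Gluing.bicoloredCycles {d N : ℕ} {c : Fin N → Finset (Fin d)} {n : Fin N → ℕ}
    (G : Gluing c n) (a : Fin d) : ℕ :=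
  Quotient.lift (fun g : LabeledGluing c n => g.graph.bicoloredCycles a)
    (fun g g' (h : ∃ φ : g.graph.Iso g'.graph, φ.white g.root = g'.root) =>
      h.elim fun φ _ => ColoredGraph.bicoloredCycles_iso φ a) G

/-- `C₀(G)`, the number of bicolored cycles that contain the color `0`. -/
noncomputable def Gluing.C₀ {d N : ℕ} {c : Fin N → Finset (Fin d)} {n : Fin N → ℕ}
    (G : Gluing c n) : ℕ :=
  ∑ a, G.bicoloredCycles a

/-- The gluings with the maximal value of `C₀`. -/
def Gluing.maximizers {d N : ℕ} (c : Fin N → Finset (Fin d)) (n : Fin N → ℕ) :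
    Set (Gluing c n) :=
  {G | ∀ G' : Gluing c n, G'.C₀ ≤ G.C₀}

/-! ## Edge-colored maps -/

/-- An oriented map without isolated vertices, as a rotation system on its half-edges (darts) `D`,
whose edges carry subsets of `[1..d]`. The vertices are the cycles of `rot`, which give the cyclic
orders around the vertices; the edges are the pairs `{x, inv x}`. -/
structure ColoredMap (d : ℕ) (D : Type) where
  rot : Equiv.Perm D
  inv : Equiv.Perm D
  col : D → Finset (Fin d)
  inv_inv : ∀ x, inv (inv x) = x
  inv_ne : ∀ x, inv x ≠ x
  col_inv : ∀ x, col (inv x) = col x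

namespace ColoredMap

variable {d : ℕ} {D : Type}

/-- Isomorphism of edge-colored maps. -/
structure Iso {D' : Type} (m : ColoredMap d D) (m' : ColoredMap d D') where
  dart : D ≃ D'
  rot : ∀ x, dart (m.rot x) = m'.rot (dart x)
  inv : ∀ x, dart (m.inv x) = m'.inv (dart x)
  col : ∀ x, m'.col (dart x) = m.col x

/-- Any two half-edges are joined by moving around vertices and across edges. -/
def Connected (m : ColoredMap d D) : Prop :=
  ∀ x y, Relation.EqvGen (fun a b => b = m.rot a ∨ b = m.inv a) x y

/-- The map is planar: by Euler's relation `V - E + F = 2 - 2 g`, a connected map has genus `0` if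
and only if `V + F = E + 2`. The faces are the cycles of `rot * inv`: cross an edge, then turn to
the next edge at the vertex. -/
def Planar (m : ColoredMap d D) : Prop :=
  numCycles m.rot + numCycles (m.rot * m.inv) = numCycles m.inv + 2

/-- Cross the edge of the half-edge `x` if its color set contains `a`, otherwise stay at `x`. -/
def cross (m : ColoredMap d D) (a : Fin d) : Equiv.Perm D :=
  Function.Involutive.toPerm (fun x => if a ∈ m.col x then m.inv x else x) (by
    intro x
    by_cases h : a ∈ m.col x
    · simp [h, m.col_inv, m.inv_inv]
    · simp [h])

/-- The number of faces of the submap of `m` with all the vertices of `m` and only the edges whose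
color sets contain `a`. Faces are followed as in `m`, except that the half-edges that do not belong
to the submap are passed over. A vertex without edges in the submap contributes one face. -/
noncomputable def faces (m : ColoredMap d D) (a : Fin d) : ℕ :=
  numCycles (m.rot * m.cross a)

theorem faces_iso {D' : Type} {m : ColoredMap d D} {m' : ColoredMap d D'} (φ : Iso m m')
    (a : Fin d) : m.faces a = m'.faces a := by
  refine numCycles_congr φ.dart _ _ fun x => ?_
  change φ.dart (m.rot (if a ∈ m.col x then m.inv x else x)) =
    m'.rot (if a ∈ m'.col (φ.dart x) then m'.inv (φ.dart x) else φ.dart x)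
  rw [φ.rot, φ.col]
  split_ifs
  · rw [φ.inv]
  · rfl

/-- The edge `{x, inv x}` is a bridge: deleting it disconnects its two ends. -/
def IsBridge (m : ColoredMap d D) (x : D) : Prop :=
  ¬ Relation.EqvGen (fun a b => b = m.rot a ∨ (b = m.inv a ∧ a ≠ x ∧ a ≠ m.inv x)) x (m.inv x)

/-- For half-edges `x` and `y` at a common vertex `v`: `v` is a cut-vertex which separates the edge
of `x` from the edge of `y`, that is, one cannot go from one edge to the other through vertices
different from `v`. -/
def CutBetween (m : ColoredMap d D) (x y : D) : Prop :=
  ¬ Relation.EqvGen (fun a b => b = m.inv a ∨ (b = m.rot a ∧ ¬ m.rot.SameCycle x a)) x y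

/-- The submap of the edges with color set `𝔠` and the submap of the edges with color set `𝔠'` can
only meet at cut-vertices, which separate the edges of the one from the edges of the other. -/
def MeetOnlyAtCutVertices (m : ColoredMap d D) (𝔠 𝔠' : Finset (Fin d)) : Prop :=
  ∀ x y, m.col x = 𝔠 → m.col y = 𝔠' → m.rot.SameCycle x y → m.CutBetween x y

end ColoredMap

/-- `m` is connected and has exactly `n i` edges with color set `c i` (hence `2 * n i` such
half-edges) and no other edges. -/
def HasEdges {d N : ℕ} (c : Fin N → Finset (Fin d)) (n : Fin N → ℕ) {D : Type}
    (m : ColoredMap d D) : Prop :=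
  m.Connected ∧ (∀ x, ∃ i, m.col x = c i) ∧ ∀ i, Nat.card {x // m.col x = c i} = 2 * n i

/-- Labeled representatives of rooted edge-colored maps. The root is a marked half-edge. -/
structure LabeledMap {d N : ℕ} (c : Fin N → Finset (Fin d)) (n : Fin N → ℕ) where
  map : ColoredMap d (Fin (size n))
  root : Fin (size n)
  hasEdges : HasEdges c n map

/-- Isomorphism of rooted edge-colored maps. -/
instance mapSetoid {d N : ℕ} (c : Fin N → Finset (Fin d)) (n : Fin N → ℕ) :
    Setoid (LabeledMap c n) where
  r m m' := ∃ φ : m.map.Iso m'.map, φ.dart m.root = m'.root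
  iseqv :=
    { refl := fun m => ⟨⟨Equiv.refl _, fun _ => rfl, fun _ => rfl, fun _ => rfl⟩, rfl⟩
      symm := by
        rintro m m' ⟨φ, h⟩
        refine ⟨⟨φ.dart.symm, fun x => ?_, fun x => ?_, fun x => ?_⟩, ?_⟩
        · rw [Equiv.symm_apply_eq, φ.rot, Equiv.apply_symm_apply]
        · rw [Equiv.symm_apply_eq, φ.inv, Equiv.apply_symm_apply]
        · rw [← φ.col, Equiv.apply_symm_apply]
        · exact (Equiv.symm_apply_eq _).2 h.symm
      trans := by
        rintro m m' m'' ⟨φ, h⟩ ⟨ψ, h'⟩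
        refine ⟨⟨φ.dart.trans ψ.dart, fun x => ?_, fun x => ?_, fun x => ?_⟩, ?_⟩
        · simp [φ.rot, ψ.rot]
        · simp [φ.inv, ψ.inv]
        · simp [φ.col, ψ.col]
        · simp [h, h'] }

/-- The set of connected rooted maps with `n i` edges of color set `c i`. -/
abbrev EdgeColoredMap {d N : ℕ} (c : Fin N → Finset (Fin d)) (n : Fin N → ℕ) : Type :=
  Quotient (mapSetoid c n)

/-- The number of faces of the submap of the edges whose color sets contain `a`. -/
noncomputable def EdgeColoredMap.faces {d N : ℕ} {c : Fin N → Finset (Fin d)} {n : Fin N → ℕ}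
    (M : EdgeColoredMap c n) (a : Fin d) : ℕ :=
  Quotient.lift (fun m : LabeledMap c n => m.map.faces a)
    (fun m m' (h : ∃ φ : m.map.Iso m'.map, φ.dart m.root = m'.root) =>
      h.elim fun φ _ => ColoredMap.faces_iso φ a) M

/-! ## The bijection -/

/-- The pairing of a colored graph whose bubbles are quartic. The bubble of the white vertex `w` is
`Q(col w)` with `col w` admissible; its other white vertex is `opp w`; and `partner w` is the black
vertex joined to `w` by the colors that are not in `col w`. -/
structure Pairing {d : ℕ} {W B : Type} (G : ColoredGraph (Fin (d + 1)) W B) where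
  partner : W ≃ B
  opp : Equiv.Perm W
  col : W → Finset (Fin d)
  opp_opp : ∀ w, opp (opp w) = w
  opp_ne : ∀ w, opp w ≠ w
  col_opp : ∀ w, col (opp w) = col w
  nonempty : ∀ w, (col w).Nonempty
  admissible : ∀ w, Admissible (col w)
  edge_eq : ∀ a w, G.edge a.succ w = partner (if a ∈ col w then opp w else w)

namespace Pairing

variable {d : ℕ} {W B : Type} {G : ColoredGraph (Fin (d + 1)) W B}

/-- Every pair of a white vertex and its black partner is merged into a half-edge, every bubble
`Q(𝔠)` becomes an edge with color set `𝔠`, and every cycle which alternates pairs and edges of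
color `0` becomes a vertex, with the cyclic order obtained by following the edges of color `0` from
black to white. -/
def toMap (P : Pairing G) : ColoredMap d W where
  rot := P.partner.trans (G.edge 0).symm
  inv := P.opp
  col := P.col
  inv_inv := P.opp_opp
  inv_ne := P.opp_ne
  col_inv := P.col_opp

theorem edge_eq_iff (P : Pairing G) (w : W) (a b : Fin d) :
    G.edge a.succ w = G.edge b.succ w ↔ (a ∈ P.col w ↔ b ∈ P.col w) := by
  have h := P.opp_ne w
  have h' := h.symm
  rw [P.edge_eq, P.edge_eq, P.partner.injective.eq_iff]
  by_cases ha : a ∈ P.col w <;> by_cases hb : b ∈ P.col w <;> simp [ha, hb, h, h']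

theorem exists_not_mem (P : Pairing G) (w : W) : ∃ a, a ∉ P.col w := by
  by_contra! h
  have h1 : P.col w = Finset.univ := Finset.eq_univ_iff_forall.2 h
  have h2 : 0 < (P.col w).card := (P.nonempty w).card_pos
  have h3 : (P.col w).card = d := by rw [h1, Finset.card_univ, Fintype.card_fin]
  rcases P.admissible w with h4 | ⟨h4, -⟩ <;> omega

theorem col_unique (P Q : Pairing G) (w : W) : P.col w = Q.col w := by
  have key : ∀ a b, (a ∈ P.col w ↔ b ∈ P.col w) ↔ (a ∈ Q.col w ↔ b ∈ Q.col w) :=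
    fun a b => (P.edge_eq_iff w a b).symm.trans (Q.edge_eq_iff w a b)
  obtain ⟨a, ha⟩ := P.nonempty w
  by_cases hq : a ∈ Q.col w
  · ext b
    have := key a b
    tauto
  · exfalso
    have hc : Q.col w = (P.col w)ᶜ := by
      ext b
      have := key a b
      simp only [Finset.mem_compl]
      tauto
    have hcard := Finset.card_add_card_compl (P.col w)
    rw [← hc, Fintype.card_fin] at hcard
    rcases P.admissible w with h1 | ⟨h1, x, hx, hx0⟩ <;>
      rcases Q.admissible w with h2 | ⟨h2, y, hy, hy0⟩
    · omega
    · omega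
    · omega
    · have hxy : x = y := Fin.ext (hx0.trans hy0.symm)
      rw [hc, Finset.mem_compl] at hy
      exact hy (hxy ▸ hx)

theorem partner_unique (P Q : Pairing G) (w : W) : P.partner w = Q.partner w := by
  obtain ⟨a, ha⟩ := P.exists_not_mem w
  have h1 := P.edge_eq a w
  have h2 := Q.edge_eq a w
  rw [← P.col_unique Q w] at h2
  simp only [ha, if_false] at h1 h2
  exact h1.symm.trans h2

theorem opp_unique (P Q : Pairing G) (w : W) : P.opp w = Q.opp w := by
  obtain ⟨a, ha⟩ := P.nonempty w
  have h1 := P.edge_eq a w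
  have h2 := Q.edge_eq a w
  rw [← P.col_unique Q w] at h2
  simp only [ha, if_true] at h1 h2
  rw [← P.partner_unique Q] at h2
  exact P.partner.injective (h1.symm.trans h2)

/-- Transport of a pairing along an isomorphism. -/
def pullback {W' B' : Type} {G' : ColoredGraph (Fin (d + 1)) W' B'} (φ : G.Iso G')
    (P : Pairing G') : Pairing G where
  partner := φ.white.trans (P.partner.trans φ.black.symm)
  opp := φ.white.trans (P.opp.trans φ.white.symm)
  col w := P.col (φ.white w)
  opp_opp w := by simp [P.opp_opp]
  opp_ne w := by simp [Equiv.symm_apply_eq, P.opp_ne]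
  col_opp w := by simp [P.col_opp]
  nonempty w := P.nonempty _
  admissible w := P.admissible _
  edge_eq a w := by
    have h := P.edge_eq a (φ.white w)
    rw [← φ.comm] at h
    rw [← Equiv.eq_symm_apply] at h
    rw [h]
    split_ifs <;> simp

theorem toMap_iso {W' B' : Type} {G' : ColoredGraph (Fin (d + 1)) W' B'} (φ : G.Iso G')
    (P : Pairing G) (P' : Pairing G') : ∃ ψ : P.toMap.Iso P'.toMap, ψ.dart = φ.white := by
  refine ⟨⟨φ.white, fun x => ?_, fun x => ?_, fun x => ?_⟩, rfl⟩
  · change φ.white ((G.edge 0).symm (P.partner x)) =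
      (G'.edge 0).symm (P'.partner (φ.white x))
    rw [P.partner_unique (P'.pullback φ), Equiv.eq_symm_apply, ← φ.comm, Equiv.apply_symm_apply]
    simp [pullback]
  · change φ.white (P.opp x) = P'.opp (φ.white x)
    rw [P.opp_unique (P'.pullback φ)]
    simp [pullback]
  · exact (P.col_unique (P'.pullback φ) x).symm

theorem toMap_connected (P : Pairing G) (hG : G.underlying.Connected) : P.toMap.Connected := by
  let R : W → W → Prop := fun a b => b = P.toMap.rot a ∨ b = P.toMap.inv a
  let f : W ⊕ B → W := Sum.elim id P.partner.symm
  have edge : ∀ c w, Relation.EqvGen R w (P.partner.symm (G.edge c w)) := by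
    intro c w
    refine Fin.cases ?_ (fun a => ?_) c
    · refine Relation.EqvGen.symm _ _ (Relation.EqvGen.rel _ _ (Or.inl ?_))
      simp [toMap]
    · rw [P.edge_eq, Equiv.symm_apply_apply]
      split_ifs
      · exact Relation.EqvGen.rel _ _ (Or.inr rfl)
      · exact Relation.EqvGen.refl _
  have walk : ∀ u v, G.underlying.Walk u v → Relation.EqvGen R (f u) (f v) := by
    intro u v p
    induction p with
    | nil => exact Relation.EqvGen.refl _
    | cons h _ ih =>
      refine Relation.EqvGen.trans _ _ _ ?_ ih
      rw [ColoredGraph.underlying, SimpleGraph.fromRel_adj] at h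
      rcases h.2 with ⟨c, w, rfl, rfl⟩ | ⟨c, w, rfl, rfl⟩
      · exact edge c w
      · exact Relation.EqvGen.symm _ _ (edge c w)
  intro x y
  obtain ⟨p⟩ := hG.preconnected (Sum.inl x) (Sum.inl y)
  exact walk _ _ p

/-- The pairing obtained from a decomposition into quartic bubbles. -/
def ofIso {N : ℕ} {c : Fin N → Finset (Fin d)} {n : Fin N → ℕ} (hne : ∀ i, (c i).Nonempty)
    (hadm : ∀ i, Admissible (c i))
    (φ : G.removeZero.Iso
      (ColoredGraph.disjointUnion fun p : (Σ i : Fin N, Fin (n i)) => quartic (c p.1))) :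
    Pairing G where
  partner := φ.white.trans φ.black.symm
  opp := φ.white.trans ((Equiv.sigmaCongrRight fun _ => Equiv.boolNot).trans φ.white.symm)
  col w := c (φ.white w).1.1
  opp_opp w := by simp
  opp_ne w h := by
    simp only [Equiv.trans_apply, Equiv.symm_apply_eq] at h
    have h' : (φ.white w).2 = !(φ.white w).2 := by
      generalize φ.white w = z at h
      obtain ⟨p, s⟩ := z
      cases s <;> simp at h
    cases hs : (φ.white w).2 <;> simp [hs] at h'
  col_opp w := by simp
  nonempty w := hne _
  admissible w := hadm _
  edge_eq a w := by
    have h := φ.comm a w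
    rw [← Equiv.eq_symm_apply] at h
    change G.edge a.succ w = _ at h
    rw [h]
    simp only [Equiv.trans_apply]
    congr 1
    simp only [ColoredGraph.disjointUnion, quartic]
    split_ifs with h1 <;> simp [h1]

theorem ofIso_card {N : ℕ} {c : Fin N → Finset (Fin d)} {n : Fin N → ℕ}
    (hc : Function.Injective c) (hne : ∀ i, (c i).Nonempty) (hadm : ∀ i, Admissible (c i))
    (φ : G.removeZero.Iso
      (ColoredGraph.disjointUnion fun p : (Σ i : Fin N, Fin (n i)) => quartic (c p.1)))
    (i : Fin N) : Nat.card {x // (ofIso hne hadm φ).col x = c i} = 2 * n i := by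
  let e : {x // (ofIso hne hadm φ).col x = c i} ≃ Fin (n i) × Bool :=
    { toFun := fun x => (Fin.cast (by rw [hc x.2]) (φ.white x.1).1.2, (φ.white x.1).2)
      invFun := fun y => ⟨φ.white.symm ⟨⟨i, y.1⟩, y.2⟩, by simp [ofIso]⟩
      left_inv := by
        rintro ⟨x, hx⟩
        have hi : (φ.white x).1.1 = i := hc hx
        subst hi
        simp
      right_inv := by
        rintro ⟨k, s⟩
        refine Prod.ext (Fin.ext ?_) ?_
        · change ((φ.white (φ.white.symm ⟨⟨i, k⟩, s⟩)).1.2 : ℕ) = k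
          rw [Equiv.apply_symm_apply]
        · simp }
  rw [Nat.card_congr e]
  simp [mul_comm]

end Pairing

theorem nonempty_pairing {d N : ℕ} {c : Fin N → Finset (Fin d)} {n : Fin N → ℕ}
    (hne : ∀ i, (c i).Nonempty) (hadm : ∀ i, Admissible (c i)) {W B : Type}
    {G : ColoredGraph (Fin (d + 1)) W B} (hG : IsGluing c n G) : Nonempty (Pairing G) :=
  hG.2.elim fun φ => ⟨Pairing.ofIso hne hadm φ⟩

theorem toMap_hasEdges {d N : ℕ} {c : Fin N → Finset (Fin d)} {n : Fin N → ℕ}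
    (hc : Function.Injective c) (hne : ∀ i, (c i).Nonempty) (hadm : ∀ i, Admissible (c i))
    {W B : Type} {G : ColoredGraph (Fin (d + 1)) W B} (hG : IsGluing c n G) (P : Pairing G) :
    HasEdges c n P.toMap := by
  obtain ⟨φ⟩ := hG.2
  have hcol : P.toMap.col = (Pairing.ofIso hne hadm φ).col :=
    funext fun w => P.col_unique _ w
  refine ⟨P.toMap_connected hG.1, fun x => ?_, fun i => ?_⟩
  · exact ⟨(φ.white x).1.1, congrFun hcol x⟩
  · rw [hcol]
    exact Pairing.ofIso_card hc hne hadm φ i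

section Bijection

variable {d N : ℕ} {c : Fin N → Finset (Fin d)} {n : Fin N → ℕ} (hc : Function.Injective c)
  (hne : ∀ i, (c i).Nonempty) (hadm : ∀ i, Admissible (c i))

/-- The map of a labeled gluing. The pairing that is chosen here is the only one. -/
noncomputable def LabeledGluing.toMap (g : LabeledGluing c n) : LabeledMap c n where
  map := (nonempty_pairing hne hadm g.isGluing).some.toMap
  root := g.root
  hasEdges := toMap_hasEdges hc hne hadm g.isGluing _

/-- The map `J` from gluings of quartic bubbles to edge-colored maps. -/
noncomputable def J : Gluing c n → EdgeColoredMap c n :=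
  Quotient.map (LabeledGluing.toMap hc hne hadm) (by
    rintro g g' ⟨φ, h⟩
    obtain ⟨ψ, hψ⟩ := Pairing.toMap_iso φ (nonempty_pairing hne hadm g.isGluing).some
      (nonempty_pairing hne hadm g'.isGluing).some
    exact ⟨ψ, by rw [hψ]; exact h⟩)

end Bijection

end QuarticGluing

/-!
The inverse of `J` splits every half-edge into a white and a black vertex joined by the colors that
are not in its label; the edges of color `0` are given by the rotation. Since the pairing of a
gluing is unique, this is inverse to `J` on isomorphism classes, and the permutation whose cycles
are the bicolored cycles with colors `0, a` is literally the one whose cycles are the faces of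
`m_a`.

For the rest, a map `m` is built from its vertices by adding its edges one at a time.
For a set `S` of edges with `k(S)` components (isolated vertices included), let
`Ψ(S) = d * k(S) + ∑_{e ∈ S} (d - |𝔠_e|) - ∑_a F(S_a)`, where `S_a` is the set of the edges of `S`
with color `a`. `ColoredMap.gap` is `2 * Ψ`. It vanishes for `S = ∅`. Adding an edge multiplies the
face permutation of `S_a`, for `a ∈ 𝔠_e`, by a transposition, which splits a face if both ends of
the edge lie on it and merges two faces otherwise. Hence `Ψ` does not change if the edge joins two
components, and increases by `(d - 2 * |𝔠_e|) + 2 * b ≥ 0` if it does not, where `b` is the number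
of `a ∈ 𝔠_e` such that the ends are on different faces of `S_a`. So `Ψ ≥ 0`, which is the upper
bound on the number of faces, and trees, for instance stars (`exists_star`), attain it.

If `Ψ` vanishes on the whole map, it vanishes on every `S`, and the edges can be added in any order.
Adding an edge `e` last shows that it is a bridge or has `d / 2` colors (`isBridge_of_gap`). If
edges `e` and `f` at `v` were connected without passing through `v`, adding `e` after `f` and the
edges that avoid `v` would give `𝔠_e ⊆ 𝔠_f` (`cutBetween_of_gap`). Planarity is itself the
vanishing of a gap, that of the map with the two colors `0, 1` in which all edges get the color `0`
(`planar_iff_gap_mono`); it holds because all edges with `d / 2` colors share their first color, and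
the others are bridges (`gap_mono_of_gap`). Conversely, the bridge and cut-vertex conditions make
every cycle of edges monochromatic with `d / 2` colors (`conn_same_color`), and planarity, which
passes to submaps, then gives `b = 0` in each step (`gap_eq_zero_of_gap_mono`).
-/

namespace QuarticGluing

/-! ### Counting the classes of an equivalence relation and the cycles of a permutation -/

/-- The smallest equivalence relation that relates `x` and `y`. -/
def pairSetoid {X : Type} (x y : X) : Setoid X :=
  Relation.EqvGen.setoid fun a b => a = x ∧ b = y

theorem pairSetoid_le {X : Type} {x y : X} {s : Setoid X} : pairSetoid x y ≤ s ↔ s x y := by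
  constructor
  · intro h
    exact h (Relation.EqvGen.rel _ _ ⟨rfl, rfl⟩)
  · intro h
    refine Setoid.eqvGen_le ?_
    rintro a b ⟨rfl, rfl⟩
    exact h

theorem sup_pairSetoid_iff {X : Type} (r : Setoid X) (x y a b : X) :
    (r ⊔ pairSetoid x y) a b ↔ r a b ∨ (r a x ∧ r b y) ∨ (r a y ∧ r b x) := by
  constructor
  · let s : Setoid X :=
      { r := fun a b => r a b ∨ (r a x ∧ r b y) ∨ (r a y ∧ r b x)
        iseqv :=
          { refl := fun a => Or.inl (r.refl a)
            symm := by
              rintro a b (h | ⟨h, h'⟩ | ⟨h, h'⟩)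
              · exact Or.inl (r.symm h)
              · exact Or.inr (Or.inr ⟨h', h⟩)
              · exact Or.inr (Or.inl ⟨h', h⟩)
            trans := by
              have tr : ∀ {a b c}, r a b → r b c → r a c := fun h h' => r.trans h h'
              have sy : ∀ {a b}, r a b → r b a := fun h => r.symm h
              rintro a b e (h | ⟨h, h'⟩ | ⟨h, h'⟩) (k | ⟨k, k'⟩ | ⟨k, k'⟩)
              · exact Or.inl (tr h k)
              · exact Or.inr (Or.inl ⟨tr h k, k'⟩)
              · exact Or.inr (Or.inr ⟨tr h k, k'⟩)
              · exact Or.inr (Or.inl ⟨h, tr (sy k) h'⟩)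
              · exact Or.inr (Or.inl ⟨h, k'⟩)
              · exact Or.inl (tr h (sy k'))
              · exact Or.inr (Or.inr ⟨h, tr (sy k) h'⟩)
              · exact Or.inl (tr h (sy k'))
              · exact Or.inr (Or.inr ⟨h, k'⟩) } }
    have h : r ⊔ pairSetoid x y ≤ s :=
      sup_le (fun {a b} h => Or.inl h)
        (pairSetoid_le.2 (Or.inr (Or.inl ⟨r.refl x, r.refl y⟩)))
    exact fun hab => h hab
  · have h1 : r ≤ r ⊔ pairSetoid x y := le_sup_left
    have h2 : (r ⊔ pairSetoid x y) x y := pairSetoid_le.1 le_sup_right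
    rintro (h | ⟨h, h'⟩ | ⟨h, h'⟩)
    · exact h1 h
    · exact Setoid.trans' _ (h1 h) (Setoid.trans' _ h2 (Setoid.symm' _ (h1 h')))
    · exact Setoid.trans' _ (h1 h) (Setoid.trans' _ (Setoid.symm' _ h2) (Setoid.symm' _ (h1 h')))

theorem card_quotient_sup_pairSetoid {X : Type} [Finite X] (r : Setoid X) {x y : X}
    (h : ¬ r x y) :
    Nat.card (Quotient (r ⊔ pairSetoid x y)) + 1 = Nat.card (Quotient r) := by
  classical
  let s := r ⊔ pairSetoid x y
  -- Every class of the join contains exactly one class of `r` other than that of `y`.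
  let f : {q : Quotient r // q ≠ Quotient.mk r y} → Quotient s := fun q =>
    Quotient.map' (s₂ := s) id (fun a b hab => (le_sup_left : r ≤ s) hab) q.1
  have hf : Function.Bijective f := by
    constructor
    · rintro ⟨p, hp⟩ ⟨q, hq⟩ hpq
      induction p using Quotient.ind with | _ p
      induction q using Quotient.ind with | _ q
      have hpy : ¬ r p y := fun h => hp (Quotient.sound h)
      have hqy : ¬ r q y := fun h => hq (Quotient.sound h)
      have h' := (sup_pairSetoid_iff r x y p q).1 (Quotient.exact hpq)
      refine Subtype.ext (Quotient.sound ?_)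
      tauto
    · intro q
      induction q using Quotient.ind with | _ q
      by_cases hq : r q y
      · refine ⟨⟨Quotient.mk r x, fun h' => h (Quotient.exact h')⟩, Quotient.sound ?_⟩
        exact (sup_pairSetoid_iff _ _ _ _ _).2 (Or.inr (Or.inl ⟨r.refl x, hq⟩))
      · exact ⟨⟨Quotient.mk r q, fun h' => hq (Quotient.exact h')⟩, rfl⟩
  have hcard : Nat.card (Quotient s) = Nat.card {q : Quotient r // q ≠ Quotient.mk r y} :=
    (Nat.card_congr (Equiv.ofBijective f hf)).symm
  change Nat.card (Quotient s) + 1 = _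
  have hfin : Finite (Quotient r) := inferInstance
  rw [hcard, ← Finite.card_option]
  exact Nat.card_congr (Equiv.optionSubtypeNe (Quotient.mk r y))

theorem sameCycle_setoid_le {X : Type} {f : Equiv.Perm X} {s : Setoid X} :
    Equiv.Perm.SameCycle.setoid f ≤ s ↔ ∀ x, s x (f x) := by
  constructor
  · intro h x
    exact h (⟨1, by simp⟩ : f.SameCycle x (f x))
  · rintro h a b ⟨i, rfl⟩
    induction i using Int.induction_on with
    | zero => exact s.refl a
    | succ i ih =>
      rw [add_comm, zpow_add, zpow_one, Equiv.Perm.mul_apply]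
      exact s.trans ih (h _)
    | pred i ih =>
      refine s.trans ih (s.symm ?_)
      have := h ((f ^ (-(i : ℤ) - 1)) a)
      rwa [← Equiv.Perm.mul_apply, ← zpow_one_add, add_sub_cancel] at this

theorem sameCycle_mul_swap {X : Type} [Finite X] [DecidableEq X] (f : Equiv.Perm X) {x y : X}
    (h : ¬ f.SameCycle x y) : (f * Equiv.swap x y).SameCycle x y := by
  obtain ⟨k, hk, hky, hmin⟩ : ∃ k, 0 < k ∧ (f ^ k) y = y ∧ ∀ j, 0 < j → j < k → (f ^ j) y ≠ y := by
    have hex : ∃ k, 0 < k ∧ (f ^ k) y = y :=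
      ⟨orderOf f, orderOf_pos f, by simp [pow_orderOf_eq_one]⟩
    refine ⟨Nat.find hex, (Nat.find_spec hex).1, (Nat.find_spec hex).2, fun j h0 hj hy => ?_⟩
    exact Nat.find_min hex hj ⟨h0, hy⟩
  -- The new permutation follows the old cycle of `y`, starting from `x`.
  have key : ∀ j, 0 < j → j ≤ k → ((f * Equiv.swap x y) ^ j) x = (f ^ j) y := by
    intro j h0 hj
    induction j with
    | zero => omega
    | succ j ih =>
      rcases Nat.eq_zero_or_pos j with rfl | hj0
      · simp
      · rw [pow_succ', Equiv.Perm.mul_apply, ih hj0 (by omega), Equiv.Perm.mul_apply,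
          Equiv.swap_apply_of_ne_of_ne, pow_succ', Equiv.Perm.mul_apply]
        · intro hx
          exact h (Equiv.Perm.SameCycle.symm ⟨j, by simpa using hx⟩)
        · exact hmin j hj0 (by omega)
  exact ⟨k, by rw [zpow_natCast, key k hk le_rfl, hky]⟩

theorem not_sameCycle_mul_swap {X : Type} [Finite X] [DecidableEq X] (f : Equiv.Perm X) {x y : X}
    (hxy : x ≠ y) (h : f.SameCycle x y) : ¬ (f * Equiv.swap x y).SameCycle x y := by
  have hex : ∃ k : ℕ, (f ^ k) x = y := by
    exact h.exists_nat_pow_eq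
  obtain ⟨k, hky, hmin⟩ : ∃ k, (f ^ k) x = y ∧ ∀ j, j < k → (f ^ j) x ≠ y :=
    ⟨Nat.find hex, Nat.find_spec hex, fun j hj => Nat.find_min hex hj⟩
  have hk0 : 0 < k := by
    rcases Nat.eq_zero_or_pos k with rfl | h0
    · exact absurd (by simpa using hky) hxy
    · exact h0
  -- The part `f x, ..., f ^ k x = y` of the old cycle is closed under the new permutation.
  let Z : Set X := {z | ∃ j, 0 < j ∧ j ≤ k ∧ (f ^ j) x = z}
  have hxZ : x ∉ Z := by
    rintro ⟨j, h0, hj, hx⟩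
    rcases hj.lt_or_eq with hj | rfl
    · refine hmin (k - j) (by omega) ?_
      calc (f ^ (k - j)) x = (f ^ (k - j)) ((f ^ j) x) := by rw [hx]
        _ = (f ^ (k - j + j)) x := by rw [pow_add, Equiv.Perm.mul_apply]
        _ = y := by rw [Nat.sub_add_cancel hj.le, hky]
    · exact hxy (hx.symm.trans hky)
  have hclosed : ∀ z ∈ Z, (f * Equiv.swap x y) z ∈ Z := by
    rintro z ⟨j, h0, hj, rfl⟩
    rcases hj.lt_or_eq with hj | rfl
    · refine ⟨j + 1, by omega, by omega, ?_⟩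
      rw [Equiv.Perm.mul_apply, Equiv.swap_apply_of_ne_of_ne, pow_succ', Equiv.Perm.mul_apply]
      · exact fun hx => hxZ ⟨j, h0, hj.le, hx⟩
      · exact hmin j hj
    · refine ⟨1, by omega, by omega, ?_⟩
      rw [hky]
      simp
  intro h'
  obtain ⟨i, hi⟩ := h'.symm.exists_nat_pow_eq
  refine hxZ (hi ▸ ?_)
  clear hi
  induction i with
  | zero => exact ⟨k, hk0, le_rfl, by simpa using hky⟩
  | succ i ih =>
    rw [pow_succ', Equiv.Perm.mul_apply]
    exact hclosed _ ih

theorem sameCycle_setoid_mul_swap_sup {X : Type} [DecidableEq X] (f : Equiv.Perm X) (x y : X) :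
    Equiv.Perm.SameCycle.setoid (f * Equiv.swap x y) ⊔ pairSetoid x y =
      Equiv.Perm.SameCycle.setoid f ⊔ pairSetoid x y := by
  have key : ∀ g : Equiv.Perm X, Equiv.Perm.SameCycle.setoid (g * Equiv.swap x y) ≤
      Equiv.Perm.SameCycle.setoid g ⊔ pairSetoid x y := by
    intro g
    rw [sameCycle_setoid_le]
    intro z
    have hg : ∀ w, (Equiv.Perm.SameCycle.setoid g ⊔ pairSetoid x y) w (g w) :=
      sameCycle_setoid_le.1 le_sup_left
    have hp : (Equiv.Perm.SameCycle.setoid g ⊔ pairSetoid x y) x y :=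
      pairSetoid_le.1 le_sup_right
    refine Setoid.trans' _ ?_ (hg _)
    rcases eq_or_ne z x with rfl | hx
    · rwa [Equiv.swap_apply_left]
    · rcases eq_or_ne z y with rfl | hy
      · rw [Equiv.swap_apply_right]
        exact Setoid.symm' _ hp
      · rw [Equiv.swap_apply_of_ne_of_ne hx hy]
  refine le_antisymm (sup_le (key f) le_sup_right) (sup_le ?_ le_sup_right)
  simpa [mul_assoc] using key (f * Equiv.swap x y)

/-- A transposition of two elements of distinct cycles merges the two cycles. -/
theorem numCycles_mul_swap_of_not_sameCycle {X : Type} [Finite X] [DecidableEq X]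
    (f : Equiv.Perm X) {x y : X} (h : ¬ f.SameCycle x y) :
    numCycles (f * Equiv.swap x y) + 1 = numCycles f := by
  have h1 := card_quotient_sup_pairSetoid (Equiv.Perm.SameCycle.setoid f) h
  have h2 : Equiv.Perm.SameCycle.setoid (f * Equiv.swap x y) ⊔ pairSetoid x y =
      Equiv.Perm.SameCycle.setoid (f * Equiv.swap x y) :=
    sup_eq_left.2 (pairSetoid_le.2 (sameCycle_mul_swap f h))
  rw [← sameCycle_setoid_mul_swap_sup, h2] at h1
  exact h1

/-- A transposition of two elements of one cycle splits this cycle. -/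
theorem numCycles_mul_swap_of_sameCycle {X : Type} [Finite X] [DecidableEq X]
    (f : Equiv.Perm X) {x y : X} (hxy : x ≠ y) (h : f.SameCycle x y) :
    numCycles (f * Equiv.swap x y) = numCycles f + 1 := by
  have := numCycles_mul_swap_of_not_sameCycle _ (not_sameCycle_mul_swap f hxy h)
  simpa [mul_assoc] using this.symm

/-- A fixed-point-free involution makes a finite type a product of its set of orbits with `Bool`. -/
theorem exists_equiv_prod_bool {X : Type} (f : Equiv.Perm X) (hf : ∀ x, f (f x) = x)
    (hne : ∀ x, f x ≠ x) :
    ∃ e : X ≃ Quotient (Equiv.Perm.SameCycle.setoid f) × Bool,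
      ∀ x, e (f x) = ((e x).1, !(e x).2) := by
  classical
  have hrel : ∀ x y, f.SameCycle x y → x = y ∨ x = f y := by
    intro x y h
    let s : Setoid X :=
      { r := fun x y => x = y ∨ x = f y
        iseqv :=
          { refl := fun _ => Or.inl rfl
            symm := by
              rintro x y (rfl | rfl)
              · exact Or.inl rfl
              · exact Or.inr (hf _).symm
            trans := by
              rintro x y z (rfl | rfl) (rfl | rfl)
              · exact Or.inl rfl
              · exact Or.inr rfl
              · exact Or.inr rfl
              · exact Or.inl (hf _) } }
    exact (sameCycle_setoid_le (s := s)).2 (fun x => Or.inr (hf x).symm) h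
  let π : X → Quotient (Equiv.Perm.SameCycle.setoid f) := Quotient.mk _
  have hπ : ∀ x, π (f x) = π x := fun x => Quotient.sound (Equiv.Perm.SameCycle.symm ⟨1, by simp⟩)
  have hout : ∀ x, x = (π x).out ∨ x = f (π x).out := fun x =>
    hrel _ _ (Equiv.Perm.SameCycle.symm (Quotient.mk_out (s := Equiv.Perm.SameCycle.setoid f) x))
  let e : X ≃ Quotient (Equiv.Perm.SameCycle.setoid f) × Bool :=
    { toFun := fun x => (π x, decide (x = (π x).out))
      invFun := fun q => if q.2 then q.1.out else f q.1.out
      left_inv := by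
        intro x
        by_cases h : x = (π x).out
        · simp [← h]
        · simpa [h] using ((hout x).resolve_left h).symm
      right_inv := by
        rintro ⟨q, _ | _⟩
        · have : π (f q.out) = q := (hπ _).trans (Quotient.out_eq q)
          simp [this, hne]
        · have : π q.out = q := Quotient.out_eq q
          simp [this] }
  refine ⟨e, fun x => Prod.ext (hπ x) ?_⟩
  change decide (f x = (π (f x)).out) = !decide (x = (π x).out)
  rw [hπ]
  by_cases h : x = (π x).out
  · rw [← h]
    simp [hne]
  · have h' := (hout x).resolve_left h
    have : f x = (π x).out := by
      conv_lhs => rw [h']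
      exact hf _
    simp [h, this]

namespace ColoredMap

variable {d : ℕ} {D : Type}

/-! ### Submaps and their components -/

/-- The equivalence relation generated by turning around vertices at the half-edges of `A` and by
crossing the edges at the half-edges of `S`. -/
def conn (m : ColoredMap d D) (A S : Set D) : Setoid D :=
  Relation.EqvGen.setoid fun a b => (b = m.rot a ∧ a ∈ A) ∨ (b = m.inv a ∧ a ∈ S)

theorem conn_rot (m : ColoredMap d D) {A : Set D} (S : Set D) {x : D} (h : x ∈ A) :
    m.conn A S x (m.rot x) :=
  Relation.EqvGen.rel _ _ (Or.inl ⟨rfl, h⟩)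

theorem conn_inv (m : ColoredMap d D) (A : Set D) {S : Set D} {x : D} (h : x ∈ S) :
    m.conn A S x (m.inv x) :=
  Relation.EqvGen.rel _ _ (Or.inr ⟨rfl, h⟩)

theorem conn_le {m : ColoredMap d D} {A S : Set D} {s : Setoid D} :
    m.conn A S ≤ s ↔ (∀ x ∈ A, s x (m.rot x)) ∧ ∀ x ∈ S, s x (m.inv x) := by
  constructor
  · intro h
    exact ⟨fun x hx => h (m.conn_rot S hx), fun x hx => h (m.conn_inv A hx)⟩
  · rintro ⟨h1, h2⟩
    refine Setoid.eqvGen_le ?_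
    rintro a b (⟨rfl, h⟩ | ⟨rfl, h⟩)
    · exact h1 a h
    · exact h2 a h

theorem conn_mono (m : ColoredMap d D) {A A' S S' : Set D} (hA : A ⊆ A') (hS : S ⊆ S') :
    m.conn A S ≤ m.conn A' S' :=
  conn_le.2 ⟨fun _ h => m.conn_rot S' (hA h), fun _ h => m.conn_inv A' (hS h)⟩

theorem connected_iff (m : ColoredMap d D) :
    m.Connected ↔ ∀ x y, m.conn Set.univ Set.univ x y := by
  have : (fun a b => b = m.rot a ∨ b = m.inv a) =
      fun a b => (b = m.rot a ∧ a ∈ Set.univ) ∨ (b = m.inv a ∧ a ∈ Set.univ) := by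
    ext
    simp
  rw [Connected, this]
  rfl

theorem isBridge_iff (m : ColoredMap d D) (x : D) :
    m.IsBridge x ↔ ¬ m.conn Set.univ {a | a ≠ x ∧ a ≠ m.inv x} x (m.inv x) := by
  have : (fun a b => b = m.rot a ∨ (b = m.inv a ∧ a ≠ x ∧ a ≠ m.inv x)) =
      fun a b => (b = m.rot a ∧ a ∈ Set.univ) ∨
        (b = m.inv a ∧ a ∈ {a | a ≠ x ∧ a ≠ m.inv x}) := by
    ext
    simp
  rw [IsBridge, this]
  rfl

theorem cutBetween_iff (m : ColoredMap d D) (x y : D) :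
    m.CutBetween x y ↔ ¬ m.conn {a | ¬ m.rot.SameCycle x a} Set.univ x y := by
  have : (fun a b => b = m.inv a ∨ (b = m.rot a ∧ ¬ m.rot.SameCycle x a)) =
      fun a b => (b = m.rot a ∧ a ∈ {a | ¬ m.rot.SameCycle x a}) ∨
        (b = m.inv a ∧ a ∈ Set.univ) := by
    ext
    simp [or_comm]
  rw [CutBetween, this]
  rfl

theorem conn_of_sameCycle (m : ColoredMap d D) {A : Set D} (S : Set D) {x y : D}
    (hA : ∀ z, m.rot.SameCycle x z → z ∈ A) (h : m.rot.SameCycle x y) : m.conn A S x y := by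
  let s : Setoid D :=
    { r := fun a b => m.rot.SameCycle a b ∧ (m.rot.SameCycle x a → m.conn A S a b)
      iseqv :=
        { refl := fun a => ⟨Equiv.Perm.SameCycle.refl _ _, fun _ => (m.conn A S).refl a⟩
          symm := fun h => ⟨h.1.symm, fun h' => (m.conn A S).symm (h.2 (h'.trans h.1.symm))⟩
          trans := fun h k => ⟨h.1.trans k.1, fun h' =>
            (m.conn A S).trans (h.2 h') (k.2 (h'.trans h.1))⟩ } }
  have hs : Equiv.Perm.SameCycle.setoid m.rot ≤ s :=
    sameCycle_setoid_le.2 fun z => ⟨⟨1, by simp⟩, fun hz => m.conn_rot S (hA z hz)⟩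
  exact (hs h).2 (Equiv.Perm.SameCycle.refl _ _)

theorem conn_univ_of_sameCycle (m : ColoredMap d D) (S : Set D) {x y : D}
    (h : m.rot.SameCycle x y) : m.conn Set.univ S x y :=
  m.conn_of_sameCycle S (fun _ _ => trivial) h

/-- A path from a loop at a vertex that does not pass through the vertex stays in the loop. -/
theorem eq_or_eq_inv_of_loop {m : ColoredMap d D} {v x y : D} (hx : m.rot.SameCycle v x)
    (hx' : m.rot.SameCycle v (m.inv x))
    (h : m.conn {a | ¬ m.rot.SameCycle v a} Set.univ x y) : y = x ∨ y = m.inv x := by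
  have hle : m.conn {a | ¬ m.rot.SameCycle v a} Set.univ ≤
      Setoid.comap (fun z => z = x ∨ z = m.inv x) ⊥ := by
    refine conn_le.2 ⟨fun z hz => propext ⟨?_, ?_⟩, fun z _ => propext ⟨?_, ?_⟩⟩
    · rintro (rfl | rfl)
      · exact absurd hx hz
      · exact absurd hx' hz
    · rintro (h | h)
      · exact absurd (Equiv.Perm.sameCycle_apply_right.1 (h ▸ hx)) hz
      · exact absurd (Equiv.Perm.sameCycle_apply_right.1 (h ▸ hx')) hz
    · rintro (rfl | rfl)
      · exact Or.inr rfl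
      · exact Or.inl (m.inv_inv _)
    · rintro (h | h)
      · exact Or.inr (by rw [← h, m.inv_inv])
      · exact Or.inl (m.inv.injective h)
  have h' : (x = x ∨ x = m.inv x) = (y = x ∨ y = m.inv x) := hle h
  exact h' ▸ Or.inl rfl

theorem conn_univ_empty (m : ColoredMap d D) :
    m.conn Set.univ ((∅ : Finset D) : Set D) = Equiv.Perm.SameCycle.setoid m.rot := by
  refine le_antisymm (conn_le.2 ⟨fun x _ => ?_, by simp⟩)
    (sameCycle_setoid_le.2 fun x => m.conn_rot _ trivial)
  exact sameCycle_setoid_le.1 le_rfl x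

/-- A set of half-edges which is a union of edges. -/
def InvClosed (m : ColoredMap d D) (S : Finset D) : Prop :=
  ∀ x ∈ S, m.inv x ∈ S

theorem InvClosed.inv_notMem {m : ColoredMap d D} {S : Finset D} (h : m.InvClosed S) {x : D}
    (hx : x ∉ S) : m.inv x ∉ S :=
  fun h' => hx (by simpa [m.inv_inv] using h _ h')

theorem InvClosed.filter_col {m : ColoredMap d D} {S : Finset D} (h : m.InvClosed S)
    (p : Finset (Fin d) → Prop) [DecidablePred p] :
    m.InvClosed (S.filter fun x => p (m.col x)) := by
  intro x hx
  simp only [Finset.mem_filter, m.col_inv] at hx ⊢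
  exact ⟨h _ hx.1, hx.2⟩

/-- The half-edges of `S` whose color set contains `a`. -/
def withColor (m : ColoredMap d D) (S : Finset D) (a : Fin d) : Finset D :=
  S.filter fun x => a ∈ m.col x

theorem InvClosed.withColor {m : ColoredMap d D} {S : Finset D} (h : m.InvClosed S) (a : Fin d) :
    m.InvClosed (m.withColor S a) :=
  h.filter_col fun 𝔠 => a ∈ 𝔠

theorem invClosed_empty (m : ColoredMap d D) : m.InvClosed ∅ :=
  fun _ h => absurd h (Finset.notMem_empty _)

theorem invClosed_univ [Fintype D] (m : ColoredMap d D) : m.InvClosed Finset.univ :=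
  fun _ _ => Finset.mem_univ _

variable [DecidableEq D]

/-- Cross the edge of the half-edge `x` if both its half-edges belong to `S`, otherwise stay at
`x`. Requiring both makes this an involution for every `S`. -/
def crossOn (m : ColoredMap d D) (S : Finset D) : Equiv.Perm D :=
  Function.Involutive.toPerm (fun x => if x ∈ S ∧ m.inv x ∈ S then m.inv x else x) (by
    intro x
    by_cases h : x ∈ S ∧ m.inv x ∈ S
    · simp [h, m.inv_inv]
    · simp [h])

theorem crossOn_apply (m : ColoredMap d D) (S : Finset D) (x : D) :
    m.crossOn S x = if x ∈ S ∧ m.inv x ∈ S then m.inv x else x :=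
  rfl

/-- The permutation whose cycles are the faces of the submap formed by all the vertices and the
edges in `S`. -/
def face (m : ColoredMap d D) (S : Finset D) : Equiv.Perm D :=
  m.rot * m.crossOn S

/-- The set `S` of half-edges together with the edge of `x`. -/
def addEdge (m : ColoredMap d D) (S : Finset D) (x : D) : Finset D :=
  insert x (insert (m.inv x) S)

theorem mem_addEdge {m : ColoredMap d D} {S : Finset D} {x y : D} :
    y ∈ m.addEdge S x ↔ y = x ∨ y = m.inv x ∨ y ∈ S := by
  simp [addEdge]

theorem subset_addEdge (m : ColoredMap d D) (S : Finset D) (x : D) : S ⊆ m.addEdge S x :=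
  fun _ h => mem_addEdge.2 (Or.inr (Or.inr h))

theorem InvClosed.addEdge {m : ColoredMap d D} {S : Finset D} (h : m.InvClosed S) (x : D) :
    m.InvClosed (m.addEdge S x) := by
  intro y hy
  rcases mem_addEdge.1 hy with rfl | rfl | hy
  · exact mem_addEdge.2 (Or.inr (Or.inl rfl))
  · exact mem_addEdge.2 (Or.inl (m.inv_inv _))
  · exact mem_addEdge.2 (Or.inr (Or.inr (h _ hy)))

theorem withColor_addEdge_of_mem (m : ColoredMap d D) (S : Finset D) {x : D} {a : Fin d}
    (h : a ∈ m.col x) : m.withColor (m.addEdge S x) a = m.addEdge (m.withColor S a) x := by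
  ext y
  simp only [withColor, Finset.mem_filter, mem_addEdge]
  constructor
  · tauto
  · rintro (rfl | rfl | h')
    · exact ⟨Or.inl rfl, h⟩
    · exact ⟨Or.inr (Or.inl rfl), by rwa [m.col_inv]⟩
    · exact ⟨Or.inr (Or.inr h'.1), h'.2⟩

theorem withColor_addEdge_of_notMem (m : ColoredMap d D) (S : Finset D) {x : D} {a : Fin d}
    (h : a ∉ m.col x) : m.withColor (m.addEdge S x) a = m.withColor S a := by
  ext y
  simp only [withColor, Finset.mem_filter, mem_addEdge]
  constructor
  · rintro ⟨rfl | rfl | h', h''⟩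
    · exact absurd h'' h
    · rw [m.col_inv] at h''
      exact absurd h'' h
    · exact ⟨h', h''⟩
  · tauto

/-- Induction from a union `S` of edges to a larger one `T`, adding one edge after the other. -/
theorem InvClosed.induction {m : ColoredMap d D} {S T : Finset D} (hS : m.InvClosed S)
    (hT : m.InvClosed T) (hST : S ⊆ T) {P : Finset D → Prop} (base : P S)
    (step : ∀ U x, S ⊆ U → U ⊆ T → m.InvClosed U → x ∈ T → x ∉ U → P U → P (m.addEdge U x)) :
    P T := by
  have key : ∀ k, ∀ U, (T \ U).card = k → S ⊆ U → U ⊆ T → m.InvClosed U → P U → P T := by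
    intro k
    induction k using Nat.strong_induction_on with
    | _ k ih =>
      intro U hk hSU hUT hU hP
      by_cases h : T ⊆ U
      · rwa [subset_antisymm h hUT]
      · obtain ⟨x, hxT, hxU⟩ := Finset.not_subset.1 h
        have hsub : m.addEdge U x ⊆ T := by
          intro y hy
          rcases mem_addEdge.1 hy with rfl | rfl | hy
          · exact hxT
          · exact hT _ hxT
          · exact hUT hy
        refine ih _ ?_ (m.addEdge U x) rfl (hSU.trans (m.subset_addEdge U x)) hsub (hU.addEdge x)
          (step U x hSU hUT hU hxT hxU hP)
        rw [← hk]
        refine Finset.card_lt_card ((Finset.ssubset_iff_of_subset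
          (Finset.sdiff_subset_sdiff subset_rfl (m.subset_addEdge U x))).2 ⟨x, ?_, ?_⟩)
        · exact Finset.mem_sdiff.2 ⟨hxT, hxU⟩
        · exact fun h => (Finset.mem_sdiff.1 h).2 (mem_addEdge.2 (Or.inl rfl))
  exact key _ S rfl subset_rfl hST hS base

theorem conn_addEdge (m : ColoredMap d D) (S : Finset D) (x : D) :
    m.conn Set.univ (m.addEdge S x) = m.conn Set.univ S ⊔ pairSetoid x (m.inv x) := by
  refine le_antisymm (conn_le.2 ⟨?_, ?_⟩) (sup_le ?_ ?_)
  · exact fun y _ => (le_sup_left : m.conn Set.univ S ≤ _) (m.conn_rot _ trivial)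
  · intro y hy
    have h : (m.conn Set.univ S ⊔ pairSetoid x (m.inv x)) x (m.inv x) :=
      pairSetoid_le.1 le_sup_right
    rcases mem_addEdge.1 hy with rfl | rfl | hy
    · exact h
    · rw [m.inv_inv]
      exact Setoid.symm' _ h
    · exact (le_sup_left : m.conn Set.univ S ≤ _) (m.conn_inv _ hy)
  · exact m.conn_mono subset_rfl (m.subset_addEdge S x)
  · exact pairSetoid_le.2 (m.conn_inv _ (mem_addEdge.2 (Or.inl rfl)))

theorem face_addEdge {m : ColoredMap d D} {S : Finset D} (hS : m.InvClosed S) {x : D}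
    (hx : x ∉ S) : m.face (m.addEdge S x) = m.face S * Equiv.swap x (m.inv x) := by
  have hx' := hS.inv_notMem hx
  rw [face, face, mul_assoc]
  congr 1
  ext y
  rw [Equiv.Perm.mul_apply]
  rcases eq_or_ne y x with rfl | h1
  · simp [crossOn_apply, mem_addEdge, hx']
  · rcases eq_or_ne y (m.inv x) with rfl | h2
    · simp [crossOn_apply, mem_addEdge, m.inv_inv, hx]
    · have h3 : m.inv y ≠ x := fun h => h2 (by rw [← h, m.inv_inv])
      have h4 : m.inv y ≠ m.inv x := fun h => h1 (m.inv.injective h)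
      simp [crossOn_apply, mem_addEdge, Equiv.swap_apply_of_ne_of_ne, h1, h2, h3]

theorem face_empty (m : ColoredMap d D) : m.face ∅ = m.rot := by
  ext
  simp [face, crossOn_apply]

theorem face_univ [Fintype D] (m : ColoredMap d D) : m.face Finset.univ = m.rot * m.inv := by
  ext
  simp [face, crossOn_apply]

theorem face_withColor_univ [Fintype D] (m : ColoredMap d D) (a : Fin d) :
    m.face (m.withColor Finset.univ a) = m.rot * m.cross a := by
  rw [face]
  congr 1
  ext x
  change (if _ then _ else _) = if _ then _ else _
  simp [withColor, m.col_inv]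

/-- A face of a submap stays in one component of it. -/
theorem conn_of_sameCycle_face {m : ColoredMap d D} {S : Finset D} {x y : D}
    (h : (m.face S).SameCycle x y) : m.conn Set.univ S x y := by
  have : Equiv.Perm.SameCycle.setoid (m.face S) ≤ m.conn Set.univ S := by
    rw [sameCycle_setoid_le]
    intro z
    rw [face, Equiv.Perm.mul_apply]
    refine Setoid.trans' _ ?_ (m.conn_rot _ trivial)
    rw [crossOn_apply]
    split_ifs with h
    · exact m.conn_inv _ h.1
    · exact Setoid.refl' _ _
  exact this h

theorem sum_addEdge {m : ColoredMap d D} {S : Finset D} (hS : m.InvClosed S) {x : D}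
    (hx : x ∉ S) :
    ∑ y ∈ m.addEdge S x, ((d : ℤ) - (m.col y).card) =
      ∑ y ∈ S, ((d : ℤ) - (m.col y).card) + 2 * (d - (m.col x).card) := by
  rw [addEdge, Finset.sum_insert, Finset.sum_insert (hS.inv_notMem hx), m.col_inv]
  · ring
  · simp [hx, (m.inv_ne x).symm]

/-! ### The gap -/

/-- Twice the amount by which the total number of faces of the colored submaps of the submap `S`
falls short of `d * k + ∑ (d - |𝔠|)`, where `k` is the number of components of `S` and the sum is
over the edges of `S`. -/
noncomputable def gap (m : ColoredMap d D) (S : Finset D) : ℤ :=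
  2 * d * Nat.card (Quotient (m.conn Set.univ S)) + ∑ x ∈ S, ((d : ℤ) - (m.col x).card) -
    2 * ∑ a, (numCycles (m.face (m.withColor S a)) : ℤ)

theorem gap_empty (m : ColoredMap d D) : m.gap ∅ = 0 := by
  have : ∀ a, m.withColor ∅ a = ∅ := fun a => by simp [withColor]
  simp only [gap, conn_univ_empty, this, face_empty, numCycles]
  simp [mul_assoc]

variable [Fintype D]

/-- The effect on the number of faces of the submap when an edge is added. -/
theorem numCycles_face_addEdge {m : ColoredMap d D} {S : Finset D} (hS : m.InvClosed S) {x : D}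
    (hx : x ∉ S) [Decidable ((m.face S).SameCycle x (m.inv x))] :
    (numCycles (m.face (m.addEdge S x)) : ℤ) =
      numCycles (m.face S) + if (m.face S).SameCycle x (m.inv x) then 1 else -1 := by
  rw [face_addEdge hS hx]
  split_ifs with h
  · rw [numCycles_mul_swap_of_sameCycle _ (m.inv_ne x).symm h]
    push_cast
    ring
  · rw [← numCycles_mul_swap_of_not_sameCycle _ h]
    push_cast
    ring

open Classical in
/-- The colors `a` of the edge of `x` such that this edge has two different faces of the submap of
the edges of `S` with color `a` at its ends. -/
noncomputable def badColors (m : ColoredMap d D) (S : Finset D) (x : D) : Finset (Fin d) :=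
  (m.col x).filter fun a => ¬ (m.face (m.withColor S a)).SameCycle x (m.inv x)

theorem mem_badColors {m : ColoredMap d D} {S : Finset D} {x : D} {a : Fin d} :
    a ∈ m.badColors S x ↔
      a ∈ m.col x ∧ ¬ (m.face (m.withColor S a)).SameCycle x (m.inv x) := by
  simp [badColors]

theorem sum_numCycles_addEdge {m : ColoredMap d D} {S : Finset D} (hS : m.InvClosed S) {x : D}
    (hx : x ∉ S) :
    ∑ a, (numCycles (m.face (m.withColor (m.addEdge S x) a)) : ℤ) =
      ∑ a, (numCycles (m.face (m.withColor S a)) : ℤ) + (m.col x).card -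
        2 * (m.badColors S x).card := by
  classical
  have h : ∀ a, (numCycles (m.face (m.withColor (m.addEdge S x) a)) : ℤ) =
      numCycles (m.face (m.withColor S a)) + (if a ∈ m.col x then 1 else 0) -
        2 * if a ∈ m.badColors S x then 1 else 0 := by
    intro a
    by_cases ha : a ∈ m.col x
    · have hxa : x ∉ m.withColor S a := fun h => hx (Finset.mem_filter.1 h).1
      rw [withColor_addEdge_of_mem _ _ ha, numCycles_face_addEdge (hS.withColor a) hxa]
      by_cases hs : (m.face (m.withColor S a)).SameCycle x (m.inv x)
      · simp [mem_badColors, ha, hs]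
      · simp only [mem_badColors, ha, hs, if_true, if_false, not_false_eq_true, and_self]
        ring
    · rw [withColor_addEdge_of_notMem _ _ ha]
      simp [mem_badColors, ha]
  simp only [h, Finset.sum_sub_distrib, Finset.sum_add_distrib, ← Finset.mul_sum]
  simp

/-- Adding an edge that joins two components does not change the gap. -/
theorem gap_addEdge_of_not_conn {m : ColoredMap d D} {S : Finset D} (hS : m.InvClosed S) {x : D}
    (hx : x ∉ S) (h : ¬ m.conn Set.univ S x (m.inv x)) : m.gap (m.addEdge S x) = m.gap S := by
  have hbad : m.badColors S x = m.col x := by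
    refine Finset.Subset.antisymm (fun a ha => (mem_badColors.1 ha).1) fun a ha => ?_
    refine mem_badColors.2 ⟨ha, fun h' => h ?_⟩
    exact m.conn_mono subset_rfl (Finset.coe_subset.2 (Finset.filter_subset _ _))
      (conn_of_sameCycle_face h')
  have hk := card_quotient_sup_pairSetoid _ h
  rw [gap, gap, sum_numCycles_addEdge hS hx, sum_addEdge hS hx, conn_addEdge, hbad, ← hk]
  push_cast
  ring

/-- Adding an edge inside a component changes the gap by a quantity that is nonnegative when
`2 * |𝔠| ≤ d`. -/
theorem gap_addEdge_of_conn {m : ColoredMap d D} {S : Finset D} (hS : m.InvClosed S) {x : D}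
    (hx : x ∉ S) (h : m.conn Set.univ S x (m.inv x)) :
    m.gap (m.addEdge S x) =
      m.gap S + (2 * (d - 2 * (m.col x).card) + 4 * (m.badColors S x).card) := by
  have hk : m.conn Set.univ S ⊔ pairSetoid x (m.inv x) = m.conn Set.univ S :=
    sup_eq_left.2 (pairSetoid_le.2 h)
  rw [gap, gap, sum_numCycles_addEdge hS hx, sum_addEdge hS hx, conn_addEdge, hk]
  ring

theorem gap_mono {m : ColoredMap d D} (hm : ∀ x, 2 * (m.col x).card ≤ d) {S T : Finset D}
    (hS : m.InvClosed S) (hT : m.InvClosed T) (hST : S ⊆ T) : m.gap S ≤ m.gap T := by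
  refine hS.induction hT hST (P := fun U => m.gap S ≤ m.gap U) le_rfl ?_
  intro U x _ _ hU _ hx ih
  by_cases h : m.conn Set.univ U x (m.inv x)
  · rw [gap_addEdge_of_conn hU hx h]
    have := hm x
    have h4 : (2 * (m.col x).card : ℤ) ≤ d := by exact_mod_cast this
    have h5 : (0 : ℤ) ≤ (m.badColors U x).card := Nat.cast_nonneg _
    linarith
  · rwa [gap_addEdge_of_not_conn hU hx h]

theorem gap_nonneg {m : ColoredMap d D} (hm : ∀ x, 2 * (m.col x).card ≤ d) {S : Finset D}
    (hS : m.InvClosed S) : 0 ≤ m.gap S :=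
  m.gap_empty ▸ gap_mono hm m.invClosed_empty hS (Finset.empty_subset _)

/-- If the gap of the map is zero, then so are the gaps of all its submaps. -/
theorem gap_eq_zero_of_univ {m : ColoredMap d D} (hm : ∀ x, 2 * (m.col x).card ≤ d)
    (h : m.gap Finset.univ = 0) {S : Finset D} (hS : m.InvClosed S) : m.gap S = 0 :=
  le_antisymm (h ▸ gap_mono hm hS m.invClosed_univ (Finset.subset_univ _)) (gap_nonneg hm hS)

/-- In a map with gap zero, an edge added inside a component has exactly `d / 2` colors, and for
each of them its ends lie on one face of the corresponding submap. -/
theorem tight_of_conn {m : ColoredMap d D} (hm : ∀ x, 2 * (m.col x).card ≤ d)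
    (h : m.gap Finset.univ = 0) {S : Finset D} (hS : m.InvClosed S) {x : D} (hx : x ∉ S)
    (hconn : m.conn Set.univ S x (m.inv x)) :
    2 * (m.col x).card = d ∧
      ∀ a ∈ m.col x, (m.face (m.withColor S a)).SameCycle x (m.inv x) := by
  have h1 := gap_addEdge_of_conn hS hx hconn
  rw [gap_eq_zero_of_univ hm h hS, gap_eq_zero_of_univ hm h (hS.addEdge x)] at h1
  have h2 := hm x
  have h3 : (m.badColors S x).card = 0 := by omega
  refine ⟨by omega, fun a ha => ?_⟩
  by_contra h4
  rw [Finset.card_eq_zero] at h3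
  have := mem_badColors.2 ⟨ha, h4⟩
  rw [h3] at this
  exact Finset.notMem_empty _ this

theorem gap_addEdge_eq_of_tight {m : ColoredMap d D} {S : Finset D} (hS : m.InvClosed S) {x : D}
    (hx : x ∉ S)
    (h : m.conn Set.univ S x (m.inv x) → 2 * (m.col x).card = d ∧
      ∀ a ∈ m.col x, (m.face (m.withColor S a)).SameCycle x (m.inv x)) :
    m.gap (m.addEdge S x) = m.gap S := by
  by_cases hc : m.conn Set.univ S x (m.inv x)
  · obtain ⟨h1, h2⟩ := h hc
    have h3 : m.badColors S x = ∅ := by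
      ext a
      simp only [mem_badColors, Finset.notMem_empty, iff_false, not_and, not_not]
      exact h2 a
    rw [gap_addEdge_of_conn hS hx hc, h3, Finset.card_empty]
    omega
  · exact gap_addEdge_of_not_conn hS hx hc

end ColoredMap

theorem Admissible.two_mul_card_le {d : ℕ} {𝔠 : Finset (Fin d)} (h : Admissible 𝔠) :
    2 * 𝔠.card ≤ d :=
  h.elim le_of_lt fun h => h.1.le

namespace ColoredMap

variable {d : ℕ} {D : Type}

/-! ### Planarity as a gap -/

/-- The same map with only two colors, all edges being of color `0`. The submap of color `1` has no
edges, so that the gap of this map is four times the genus of a connected map. -/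
def mono (m : ColoredMap d D) : ColoredMap 2 D where
  rot := m.rot
  inv := m.inv
  col _ := {0}
  inv_inv := m.inv_inv
  inv_ne := m.inv_ne
  col_inv _ := rfl

theorem mono_card (m : ColoredMap d D) (x : D) : 2 * (m.mono.col x).card ≤ 2 :=
  le_rfl

theorem mono_withColor_zero (m : ColoredMap d D) (S : Finset D) : m.mono.withColor S 0 = S := by
  simp [withColor, mono]

theorem mono_withColor_one (m : ColoredMap d D) (S : Finset D) : m.mono.withColor S 1 = ∅ := by
  simp [withColor, mono]

theorem natCard_eq_two_mul_numCycles_inv (m : ColoredMap d D) :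
    Nat.card D = 2 * numCycles m.inv := by
  obtain ⟨e, -⟩ := exists_equiv_prod_bool m.inv m.inv_inv m.inv_ne
  rw [Nat.card_congr e, Nat.card_prod, numCycles]
  simp [mul_comm]

theorem Connected.card_quotient {m : ColoredMap d D} [Nonempty D] (h : m.Connected) :
    Nat.card (Quotient (m.conn Set.univ Set.univ)) = 1 := by
  rw [connected_iff] at h
  rw [Nat.card_eq_one_iff_unique]
  refine ⟨⟨fun p q => ?_⟩, ⟨Quotient.mk _ (Classical.arbitrary D)⟩⟩
  induction p using Quotient.ind
  induction q using Quotient.ind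
  exact Quotient.sound (h _ _)

variable [DecidableEq D] [Fintype D]

theorem planar_iff_gap_mono [Nonempty D] {m : ColoredMap d D} (h : m.Connected) :
    m.Planar ↔ m.mono.gap Finset.univ = 0 := by
  have h1 : Nat.card (Quotient (m.mono.conn Set.univ ((Finset.univ : Finset D) : Set D))) = 1 := by
    rw [Finset.coe_univ]
    exact h.card_quotient
  have h2 : ∀ S, m.mono.face S = m.face S := fun _ => rfl
  have h3 := m.natCard_eq_two_mul_numCycles_inv
  rw [Nat.card_eq_fintype_card] at h3
  have h4 : ∑ x : D, (((2 : ℕ) : ℤ) - (m.mono.col x).card) = 2 * numCycles m.inv := by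
    simp [mono, h3]
  rw [gap, h1, h4, Fin.sum_univ_two, mono_withColor_zero, mono_withColor_one, h2, h2, face_univ,
    face_empty, Planar]
  push_cast
  omega

/-! ### Cycles of edges are monochromatic -/

/-- The half-edges of the edges of `S` which have no end in `U`. -/
def off (m : ColoredMap d D) (S U : Finset D) : Set D :=
  {a | a ∈ S ∧ a ∉ U ∧ m.inv a ∉ U}

/-- The half-edges at the vertex of `p`, added to the set `U`. -/
noncomputable def addVertex (m : ColoredMap d D) (U : Finset D) (p : D) : Finset D :=
  U ∪ Set.Finite.toFinset (Set.toFinite {a | m.rot.SameCycle p a})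

theorem mem_addVertex {m : ColoredMap d D} {U : Finset D} {p a : D} :
    a ∈ m.addVertex U p ↔ a ∈ U ∨ m.rot.SameCycle p a := by
  simp [addVertex]

/-- Let `U` be a set of vertices and `b` be connected outside `U` to a vertex `v` which is neither
in `U` nor the vertex of `b`. The first edge through which a path from `b` enters `v` has an end
that is connected to `b` outside `U` and `v`. -/
theorem exists_entering_edge {m : ColoredMap d D} {S U : Finset D} (hS : m.InvClosed S) {b p : D}
    (hb : ¬ m.rot.SameCycle p b)
    (h : m.conn {a | a ∉ U} (m.off S U) b p) :
    ∃ w ∈ S, m.rot.SameCycle p w ∧ m.inv w ∉ m.addVertex U p ∧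
      m.conn {a | a ∉ m.addVertex U p} (m.off S (m.addVertex U p)) b (m.inv w) := by
  by_contra hno
  let r := m.conn {a | a ∉ m.addVertex U p} (m.off S (m.addVertex U p))
  -- Without such an edge, the part reached from `b` outside `v` would be closed.
  let Q : D → Prop := fun z => ¬ m.rot.SameCycle p z ∧ r b z
  have hrot : ∀ z, z ∉ U → (Q z ↔ Q (m.rot z)) := by
    intro z hz
    have h1 : m.rot.SameCycle p z ↔ m.rot.SameCycle p (m.rot z) :=
      Equiv.Perm.sameCycle_apply_right.symm
    change (_ ∧ _) ↔ (_ ∧ _)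
    rw [← h1]
    refine and_congr_right fun hpz => ?_
    have h2 : r z (m.rot z) :=
      m.conn_rot _ (show z ∉ m.addVertex U p from fun h => (mem_addVertex.1 h).elim hz hpz)
    exact ⟨fun h => Setoid.trans' _ h h2, fun h => Setoid.trans' _ h (Setoid.symm' _ h2)⟩
  have hinv : ∀ z ∈ m.off S U, Q z → Q (m.inv z) := by
    rintro z ⟨hzS, hzU, hzU'⟩ ⟨hpz, hbz⟩
    have h1 : z ∉ m.addVertex U p := fun h => (mem_addVertex.1 h).elim hzU hpz
    by_cases h2 : m.rot.SameCycle p (m.inv z)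
    · exact absurd ⟨m.inv z, hS _ hzS, h2, by rwa [m.inv_inv], by rwa [m.inv_inv]⟩ hno
    · have h3 : m.inv z ∉ m.addVertex U p := fun h => (mem_addVertex.1 h).elim hzU' h2
      exact ⟨h2, Setoid.trans' _ hbz (m.conn_inv _ ⟨hzS, h1, h3⟩)⟩
  let s : Setoid D := Setoid.comap Q ⊥
  have hle : m.conn {a | a ∉ U} (m.off S U) ≤ s := by
    refine conn_le.2 ⟨fun z hz => propext (hrot z hz), fun z hz => propext ⟨hinv z hz, ?_⟩⟩
    have hz' : m.inv z ∈ m.off S U := ⟨hS _ hz.1, hz.2.2, by rw [m.inv_inv]; exact hz.2.1⟩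
    intro h
    simpa [m.inv_inv] using hinv _ hz' h
  have hQ : Q b = Q p := hle h
  have hQp : Q p := hQ ▸ ⟨hb, Setoid.refl' _ _⟩
  exact hQp.1 (Equiv.Perm.SameCycle.refl _ _)

/-- Two half-edges `p` and `z` of one color are given, joined inside the set `U` of vertices, such
that the vertex of `p` and the other end of `z` are joined by edges of `S` outside `U`. If distinct
colors meet only at separating cut-vertices, then they are also joined by edges of `S` of the color
of `p`: the last edge of a path from `z` to the vertex of `p` has this color, and one continues from
its other end, after adding the vertex of `p` to `U`. -/
theorem conn_same_color_aux {m : ColoredMap d D} {S : Finset D} (hS : m.InvClosed S)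
    (hcut : ∀ x y, m.col x ≠ m.col y → m.rot.SameCycle x y → m.CutBetween x y) (k : ℕ) :
    ∀ (U : Finset D) (p z : D), Uᶜ.card = k → p ∉ U → m.inv z ∉ U →
      (∀ a b, m.rot.SameCycle a b → a ∈ U → b ∈ U) → m.conn U Set.univ p z →
      m.conn {a | a ∉ U} (m.off S U) p (m.inv z) →
      m.conn Set.univ {a | a ∈ S ∧ m.col a = m.col p} p (m.inv z) := by
  induction k using Nat.strong_induction_on with
  | _ k ih =>
    intro U p z hk hp hz hU hin hout
    by_cases hpz : m.rot.SameCycle p (m.inv z)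
    · exact m.conn_univ_of_sameCycle _ hpz
    obtain ⟨w, hwS, hpw, hw, hconn⟩ := exists_entering_edge hS hpz (Setoid.symm' _ hout)
    have hdisj : ∀ a ∈ U, ¬ m.rot.SameCycle p a := fun a ha h => hp (hU _ _ h.symm ha)
    have hcol : m.col p = m.col w := by
      by_contra hne
      refine (m.cutBetween_iff p w).1 (hcut p w hne hpw) ?_
      have h1 : m.conn {a | ¬ m.rot.SameCycle p a} Set.univ p z :=
        m.conn_mono (fun a ha => hdisj a ha) subset_rfl hin
      have h2 : m.conn {a | ¬ m.rot.SameCycle p a} Set.univ (m.inv z) (m.inv w) :=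
        m.conn_mono (fun a ha h => (ha : a ∉ m.addVertex U p) (mem_addVertex.2 (Or.inr h)))
          (Set.subset_univ _) hconn
      exact Setoid.trans' _ (Setoid.trans' _ h1 (m.conn_inv _ trivial))
        (Setoid.trans' _ h2 (Setoid.symm' _ (m.conn_inv _ trivial)))
    have hcard : (m.addVertex U p)ᶜ.card < k := by
      rw [← hk]
      refine Finset.card_lt_card (Finset.compl_ssubset_compl.2
        ((Finset.ssubset_iff_of_subset fun a ha => mem_addVertex.2 (Or.inl ha)).2 ⟨p, ?_, hp⟩))
      exact mem_addVertex.2 (Or.inr (Equiv.Perm.SameCycle.refl _ _))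
    have hin' : m.conn (m.addVertex U p) Set.univ (m.inv w) z := by
      have h1 : m.conn (m.addVertex U p) Set.univ p w :=
        m.conn_of_sameCycle _ (fun a ha => Finset.mem_coe.2 (mem_addVertex.2 (Or.inr ha))) hpw
      have h2 : m.conn (m.addVertex U p) Set.univ p z :=
        m.conn_mono (fun a ha => Finset.mem_coe.2 (mem_addVertex.2 (Or.inl ha))) subset_rfl hin
      exact Setoid.trans' _ (Setoid.symm' _ (m.conn_inv _ trivial))
        (Setoid.trans' _ (Setoid.symm' _ h1) h2)
    have h := ih _ hcard (m.addVertex U p) (m.inv w) z rfl hw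
      (fun h => (mem_addVertex.1 h).elim hz hpz)
      (fun a b hab ha => mem_addVertex.2 ((mem_addVertex.1 ha).imp (hU a b hab)
        fun h => h.trans hab)) hin' (Setoid.symm' _ hconn)
    rw [m.col_inv, ← hcol] at h
    exact Setoid.trans' _ (m.conn_univ_of_sameCycle _ hpw)
      (Setoid.trans' _ (m.conn_inv _ ⟨hwS, hcol.symm⟩) h)

/-- If distinct colors meet only at separating cut-vertices and the ends of the edge of `x` are
joined by edges of `S`, then they are joined by edges of `S` with the color set of `x`. -/
theorem conn_same_color {m : ColoredMap d D} {S : Finset D} (hS : m.InvClosed S)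
    (hcut : ∀ x y, m.col x ≠ m.col y → m.rot.SameCycle x y → m.CutBetween x y) {x : D}
    (h : m.conn Set.univ S x (m.inv x)) :
    m.conn Set.univ {a | a ∈ S ∧ m.col a = m.col x} x (m.inv x) := by
  refine conn_same_color_aux hS hcut _ ∅ x x rfl (Finset.notMem_empty _) (Finset.notMem_empty _)
    (fun _ _ _ h => absurd h (Finset.notMem_empty _)) (Setoid.refl' _ _) ?_
  refine m.conn_mono (fun a _ => Finset.notMem_empty a) (fun a ha => ?_) h
  exact ⟨ha, Finset.notMem_empty _, Finset.notMem_empty _⟩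

/-! ### The maps with gap zero -/

theorem isBridge_of_gap {m : ColoredMap d D} (hm : ∀ x, 2 * (m.col x).card ≤ d)
    (h : m.gap Finset.univ = 0) {x : D} (hx : 2 * (m.col x).card < d) : m.IsBridge x := by
  rw [isBridge_iff]
  intro hconn
  have hS : m.InvClosed (Finset.univ.filter fun a => a ≠ x ∧ a ≠ m.inv x) := by
    intro a ha
    simp only [Finset.mem_filter, Finset.mem_univ, true_and] at ha ⊢
    exact ⟨fun h => ha.2 (by rw [← h, m.inv_inv]), fun h => ha.1 (m.inv.injective h)⟩
  have := (tight_of_conn hm h hS (x := x) (by simp) 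
    (m.conn_mono subset_rfl (fun a ha => by simpa using ha) hconn)).1
  omega

/-- The edges with `d / 2` colors all have the first color, so that the submap they form is the
submap of this color, which has no genus; the other edges are bridges. -/
theorem gap_mono_of_gap {m : ColoredMap d D} (hm : ∀ x, Admissible (m.col x))
    (h : m.gap Finset.univ = 0) : m.mono.gap Finset.univ = 0 := by
  have hm' := fun x => (hm x).two_mul_card_le
  let H : Finset D := Finset.univ.filter fun x => 2 * (m.col x).card = d
  have hmemH : ∀ x, x ∈ H ↔ 2 * (m.col x).card = d := fun x => by simp [H]
  have hH : m.InvClosed H := m.invClosed_univ.filter_col fun 𝔠 => 2 * 𝔠.card = d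
  have first : ∀ x ∈ H, ∃ a ∈ m.col x, a.val = 0 := by
    intro x hx
    rw [hmemH] at hx
    exact (hm x).elim (fun h => by omega) And.right
  have h1 : m.mono.gap H = 0 := by
    refine InvClosed.induction (m := m.mono) (P := fun S => m.mono.gap S = 0)
      m.mono.invClosed_empty hH (Finset.empty_subset _) m.mono.gap_empty ?_
    intro S x _ hSH hS hxH hxS ih
    rw [gap_addEdge_eq_of_tight hS hxS, ih]
    intro hconn
    refine ⟨rfl, fun b hb => ?_⟩
    obtain rfl : b = 0 := by simpa [mono] using hb
    obtain ⟨a, ha, ha0⟩ := first x hxH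
    have hSa : m.withColor S a = S := by
      refine Finset.filter_true_of_mem fun y hy => ?_
      obtain ⟨a', ha', ha0'⟩ := first y (hSH hy)
      rwa [Fin.ext (ha0.trans ha0'.symm)]
    have := (tight_of_conn hm' h hS hxS hconn).2 a ha
    rw [hSa] at this
    rw [mono_withColor_zero]
    exact this
  refine InvClosed.induction (m := m.mono) (P := fun S => m.mono.gap S = 0) hH m.mono.invClosed_univ
    (Finset.subset_univ _) h1 ?_
  intro S x hHS _ hS _ hxS ih
  rw [gap_addEdge_of_not_conn hS hxS, ih]
  intro hconn
  exact hxS (hHS ((hmemH x).2 (tight_of_conn hm' h hS hxS hconn).1))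

/-- If half-edges `x` and `y` at a vertex `v` are connected without passing through `v`, and their
edges are not loops, then the other ends of their edges are connected by the edges that do not
touch `v`. -/
theorem conn_inv_inv_off {m : ColoredMap d D} {x y : D} {V : Finset D}
    (hV : ∀ a, a ∈ V ↔ m.rot.SameCycle x a) (hxy : m.rot.SameCycle x y)
    (hx : m.inv x ∉ V) (hy : m.inv y ∉ V)
    (h : m.conn {a | ¬ m.rot.SameCycle x a} Set.univ x y) :
    m.conn Set.univ (m.off Finset.univ V) (m.inv x) (m.inv y) := by
  let r := m.conn Set.univ (m.off Finset.univ V)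
  -- Retract every half-edge at `v` to the other end of its edge, unless this edge is a loop.
  let φ : D → D := fun z => if z ∈ V ∧ m.inv z ∉ V then m.inv z else z
  have hle : m.conn {a | ¬ m.rot.SameCycle x a} Set.univ ≤ Setoid.comap φ r := by
    refine conn_le.2 ⟨fun z hz => ?_, fun z _ => ?_⟩
    · have h1 : z ∉ V := fun h => hz ((hV z).1 h)
      have h2 : m.rot z ∉ V := fun h =>
        hz (Equiv.Perm.sameCycle_apply_right.1 ((hV _).1 h))
      change r (φ z) (φ (m.rot z))
      simp only [φ, h1, h2, false_and, if_false]
      exact m.conn_rot _ trivial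
    · change r (φ z) (φ (m.inv z))
      by_cases h1 : z ∈ V <;> by_cases h2 : m.inv z ∈ V
      · simp only [φ, m.inv_inv, h1, h2, not_true, and_false, if_false]
        exact m.conn_univ_of_sameCycle _ (((hV _).1 h1).symm.trans ((hV _).1 h2))
      · simp only [φ, h1, h2, m.inv_inv, not_false_eq_true, and_self, if_true, false_and, if_false]
        exact Setoid.refl' _ _
      · simp only [φ, h1, h2, m.inv_inv, not_false_eq_true, and_self, if_true, false_and, if_false]
        exact Setoid.refl' _ _
      · simp only [φ, h1, h2, false_and, if_false]
        exact m.conn_inv _ ⟨Finset.mem_univ _, h1, h2⟩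
  have h' : r (φ x) (φ y) := hle h
  have hxV : x ∈ V := (hV x).2 (Equiv.Perm.SameCycle.refl _ _)
  have hyV : y ∈ V := (hV y).2 hxy
  simpa only [φ, hxV, hyV, hx, hy, not_false_eq_true, and_self, if_true] using h'

/-- Otherwise there would be a cycle through the edges of `x` and `y` which touches their common
vertex only in these two edges. The edge of `x` closes the cycle, so that each of its colors must be
present along the whole cycle, in particular on the edge of `y`, which has at most `d / 2`
colors. -/
theorem cutBetween_of_gap {m : ColoredMap d D} (hm : ∀ x, 2 * (m.col x).card ≤ d)
    (h : m.gap Finset.univ = 0) {x y : D} (hne : m.col x ≠ m.col y)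
    (hxy : m.rot.SameCycle x y) : m.CutBetween x y := by
  rw [cutBetween_iff]
  intro hconn
  let V : Finset D := m.addVertex ∅ x
  have hV : ∀ a, a ∈ V ↔ m.rot.SameCycle x a := fun a => by simp [V, mem_addVertex]
  have hxV : x ∈ V := (hV x).2 (Equiv.Perm.SameCycle.refl _ _)
  have hyV : y ∈ V := (hV y).2 hxy
  have hxi : m.inv x ∉ V := by
    intro hx
    rcases eq_or_eq_inv_of_loop (Equiv.Perm.SameCycle.refl _ _) ((hV _).1 hx) hconn with rfl | rfl
    · exact hne rfl
    · exact hne (m.col_inv x).symm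
  have hyi : m.inv y ∉ V := by
    intro hy
    rcases eq_or_eq_inv_of_loop hxy ((hV _).1 hy) (Setoid.symm' _ hconn) with rfl | rfl
    · exact hne rfl
    · exact hne (m.col_inv y)
  let S : Finset D := Finset.univ.filter fun a => a ∉ V ∧ m.inv a ∉ V
  have hmemS : ∀ a, a ∈ S ↔ a ∉ V ∧ m.inv a ∉ V := fun a => by simp [S]
  have hS : m.InvClosed S := by
    intro a ha
    rw [hmemS] at ha ⊢
    rw [m.inv_inv]
    exact ha.symm
  have hoff : m.off Finset.univ V ⊆ S := fun a ha => (hmemS a).2 ha.2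
  let T : Finset D := m.addEdge S y
  have hT : m.InvClosed T := hS.addEdge y
  have hxT : x ∉ T := by
    intro hx
    rcases mem_addEdge.1 hx with rfl | hx | hx
    · exact hne rfl
    · exact hne (hx ▸ m.col_inv y)
    · exact ((hmemS x).1 hx).1 hxV
  have hTconn : m.conn Set.univ T x (m.inv x) := by
    have h1 : m.conn Set.univ T (m.inv x) (m.inv y) :=
      m.conn_mono subset_rfl (hoff.trans (m.subset_addEdge S y))
        (conn_inv_inv_off hV hxy hxi hyi hconn)
    have h2 : m.conn Set.univ T y (m.inv y) :=
      m.conn_inv _ (Finset.mem_coe.2 (mem_addEdge.2 (Or.inl rfl)))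
    exact Setoid.trans' _ (m.conn_univ_of_sameCycle _ hxy)
      (Setoid.trans' _ h2 (Setoid.symm' _ h1))
  obtain ⟨hcard, htight⟩ := tight_of_conn hm h hT hxT hTconn
  have hsub : m.col x ⊆ m.col y := by
    intro a ha
    by_contra hay
    have h1 := conn_of_sameCycle_face (htight a ha)
    rw [withColor_addEdge_of_notMem _ _ hay] at h1
    -- Without the edge of `y`, the vertex of `x` is isolated.
    have hle : m.conn Set.univ (m.withColor S a) ≤ Setoid.comap (· ∈ V) ⊥ := by
      refine conn_le.2 ⟨fun z _ => propext ?_, fun z hz => propext ?_⟩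
      · change z ∈ V ↔ m.rot z ∈ V
        rw [hV, hV, Equiv.Perm.sameCycle_apply_right]
      · have hzS := (hmemS z).1 (Finset.mem_filter.1 hz).1
        exact iff_of_false hzS.1 hzS.2
    have h2 : (x ∈ V) = (m.inv x ∈ V) := hle h1
    exact hxi (h2 ▸ hxV)
  refine hne (Finset.eq_of_subset_of_card_le hsub ?_)
  have := hm y
  omega

/-- A cycle of edges is monochromatic by the cut-vertex condition, with a color set of size `d / 2`
by the bridge condition. Planarity then puts the two ends of an edge that closes a cycle on one
face of each submap which contains the cycle. -/
theorem gap_eq_zero_of_gap_mono {m : ColoredMap d D} (hm : ∀ x, 2 * (m.col x).card ≤ d)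
    (hplanar : m.mono.gap Finset.univ = 0)
    (hbridge : ∀ x, 2 * (m.col x).card < d → m.IsBridge x)
    (hcut : ∀ x y, m.col x ≠ m.col y → m.rot.SameCycle x y → m.CutBetween x y) :
    m.gap Finset.univ = 0 := by
  refine m.invClosed_empty.induction (P := fun S => m.gap S = 0) m.invClosed_univ
    (Finset.empty_subset _) m.gap_empty ?_
  intro S x _ _ hS _ hxS ih
  rw [gap_addEdge_eq_of_tight hS hxS, ih]
  intro hconn
  refine ⟨le_antisymm (hm x) (not_lt.1 fun hlt => ?_), fun a ha => ?_⟩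
  · have hsub : (S : Set D) ⊆ {a | a ≠ x ∧ a ≠ m.inv x} := by
      intro z hz
      exact ⟨fun h => hxS (h ▸ hz), fun h => hS.inv_notMem hxS (h ▸ hz)⟩
    exact (m.isBridge_iff x).1 (hbridge x hlt) (m.conn_mono subset_rfl hsub hconn)
  · have h1 : m.conn Set.univ (m.withColor S a) x (m.inv x) :=
      m.conn_mono subset_rfl
        (fun z hz => Finset.mem_coe.2 (Finset.mem_filter.2 ⟨hz.1, hz.2 ▸ ha⟩))
        (conn_same_color hS hcut hconn)
    have h2 : x ∉ m.withColor S a := fun h => hxS (Finset.mem_filter.1 h).1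
    have h3 := (tight_of_conn m.mono_card hplanar (S := m.withColor S a)
      (hS.withColor a) h2 h1).2 0 (by simp [mono])
    rwa [mono_withColor_zero] at h3

/-- The maps with gap zero are those with the three geometric properties. -/
theorem gap_eq_zero_iff [Nonempty D] {m : ColoredMap d D} (hm : ∀ x, Admissible (m.col x))
    (hconn : m.Connected) :
    m.gap Finset.univ = 0 ↔ m.Planar ∧ (∀ x, 2 * (m.col x).card < d → m.IsBridge x) ∧
      ∀ x y, m.col x ≠ m.col y → m.rot.SameCycle x y → m.CutBetween x y := by
  have hm' := fun x => (hm x).two_mul_card_le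
  rw [planar_iff_gap_mono hconn]
  constructor
  · intro h
    exact ⟨gap_mono_of_gap hm h, fun x hx => isBridge_of_gap hm' h hx,
      fun x y hne hxy => cutBetween_of_gap hm' h hne hxy⟩
  · rintro ⟨h1, h2, h3⟩
    exact gap_eq_zero_of_gap_mono hm' h1 h2 h3

end ColoredMap
/-! ### The inverse of the bijection -/

theorem exists_equiv_fin_prod_bool {X : Type} (f : Equiv.Perm X) (hf : ∀ x, f (f x) = x)
    (hne : ∀ x, f x ≠ x) [Finite X] {k : ℕ} (hk : Nat.card X = 2 * k) :
    ∃ e : X ≃ Fin k × Bool, ∀ x, e (f x) = ((e x).1, !(e x).2) := by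
  obtain ⟨e, he⟩ := exists_equiv_prod_bool f hf hne
  have hq : Nat.card (Quotient (Equiv.Perm.SameCycle.setoid f)) = k := by
    have h := Nat.card_congr e
    rw [Nat.card_prod, hk] at h
    simp only [Nat.card_eq_fintype_card, Fintype.card_bool] at h
    omega
  refine ⟨e.trans ((Finite.equivFinOfCardEq hq).prodCongr (Equiv.refl Bool)), fun x => ?_⟩
  simp [he]

variable {d N : ℕ} {c : Fin N → Finset (Fin d)} {n : Fin N → ℕ}

namespace HasEdges

variable {D : Type} {m : ColoredMap d D}

/-- The half-edges of a map are those of `n i` edges of color set `c i`. -/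
theorem exists_equiv [Finite D] (hc : Function.Injective c) (h : HasEdges c n m) :
    ∃ e : D ≃ Σ _ : (Σ i : Fin N, Fin (n i)), Bool,
      (∀ x, c (e x).1.1 = m.col x) ∧ ∀ x, e (m.inv x) = ⟨(e x).1, !(e x).2⟩ := by
  choose idx hidx using h.2.1
  have hinv : ∀ x, idx (m.inv x) = idx x := fun x => hc (by rw [← hidx, ← hidx, m.col_inv])
  have key : ∀ i, ∃ e : {x // idx x = i} ≃ Fin (n i) × Bool, ∀ x (hx : idx x = i),
      e ⟨m.inv x, (hinv x).trans hx⟩ = ((e ⟨x, hx⟩).1, !(e ⟨x, hx⟩).2) := by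
    intro i
    have hcard : Nat.card {x // idx x = i} = 2 * n i := by
      rw [← h.2.2 i]
      refine Nat.card_congr (Equiv.subtypeEquivRight fun x => ?_)
      rw [hidx]
      exact hc.eq_iff.symm
    obtain ⟨e, he⟩ := exists_equiv_fin_prod_bool
      (m.inv.subtypePerm (p := fun x => idx x = i) fun x => by rw [hinv])
      (fun x => Subtype.ext (m.inv_inv x.1))
      (fun x hx => m.inv_ne x.1 (congrArg Subtype.val hx)) hcard
    exact ⟨e, fun x hx => he ⟨x, hx⟩⟩
  choose e he using key
  let s : (Σ i, Fin (n i) × Bool) ≃ Σ _ : (Σ i : Fin N, Fin (n i)), Bool :=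
    { toFun := fun q => ⟨⟨q.1, q.2.1⟩, q.2.2⟩
      invFun := fun q => ⟨q.1.1, q.1.2, q.2⟩
      left_inv := fun _ => rfl
      right_inv := fun _ => rfl }
  refine ⟨((Equiv.sigmaFiberEquiv idx).symm.trans (Equiv.sigmaCongrRight e)).trans s,
    fun x => (hidx x).symm, fun x => ?_⟩
  have h1 : (Equiv.sigmaFiberEquiv idx).symm (m.inv x) = ⟨idx x, ⟨m.inv x, hinv x⟩⟩ := by
    rw [Equiv.symm_apply_eq]
    rfl
  have h2 : (Equiv.sigmaFiberEquiv idx).symm x = ⟨idx x, ⟨x, rfl⟩⟩ := rfl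
  simp only [Equiv.trans_apply, h1, h2, Equiv.sigmaCongrRight_apply, he]
  rfl

end HasEdges

/-- The colored graph of an edge-colored map: every half-edge is split into a white and a black
vertex, both denoted by the half-edge. -/
def ColoredMap.toGraph {D : Type} (m : ColoredMap d D) : ColoredGraph (Fin (d + 1)) D D where
  edge := Fin.cases m.rot.symm m.cross

/-- The evident pairing of the colored graph of a map. -/
def ColoredMap.pairing {D : Type} (m : ColoredMap d D) (hne : ∀ x, (m.col x).Nonempty)
    (hadm : ∀ x, Admissible (m.col x)) : Pairing m.toGraph where
  partner := Equiv.refl D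
  opp := m.inv
  col := m.col
  opp_opp := m.inv_inv
  opp_ne := m.inv_ne
  col_opp := m.col_inv
  nonempty := hne
  admissible := hadm
  edge_eq _ _ := rfl

theorem ColoredGraph.reachable_edge {C W B : Type} (G : ColoredGraph C W B) (a : C) (w : W) :
    G.underlying.Reachable (Sum.inl w) (Sum.inr (G.edge a w)) := by
  refine SimpleGraph.Adj.reachable ?_
  rw [underlying, SimpleGraph.fromRel_adj]
  exact ⟨by simp, Or.inl ⟨a, w, rfl, rfl⟩⟩

theorem ColoredMap.toGraph_connected {D : Type} [Nonempty D] {m : ColoredMap d D}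
    (hne : ∀ x, (m.col x).Nonempty) (hadm : ∀ x, Admissible (m.col x)) (h : m.Connected) :
    m.toGraph.underlying.Connected := by
  have h0 : ∀ w, m.toGraph.underlying.Reachable (Sum.inl w) (Sum.inr w) := by
    intro w
    obtain ⟨a, ha⟩ := (m.pairing hne hadm).exists_not_mem w
    have h1 := m.toGraph.reachable_edge a.succ w
    rw [(m.pairing hne hadm).edge_eq, if_neg ha] at h1
    exact h1
  have h1 : m.conn Set.univ Set.univ ≤
      Setoid.comap Sum.inl m.toGraph.underlying.reachableSetoid := by
    refine conn_le.2 ⟨fun w _ => ?_, fun w _ => ?_⟩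
    · have h2 := m.toGraph.reachable_edge 0 (m.rot w)
      have h3 : m.toGraph.edge 0 (m.rot w) = w := m.rot.symm_apply_apply w
      rw [h3] at h2
      exact (h0 w).trans h2.symm
    · obtain ⟨a, ha⟩ : ∃ a, a ∈ (m.pairing hne hadm).col w := hne w
      have h2 := m.toGraph.reachable_edge a.succ w
      rw [(m.pairing hne hadm).edge_eq, if_pos ha] at h2
      exact h2.trans (h0 _).symm
  have h2 : ∀ x y, m.toGraph.underlying.Reachable (Sum.inl x) (Sum.inl y) :=
    fun x y => h1 (m.connected_iff.1 h x y)
  have h3 : ∀ u : D ⊕ D, ∃ x, m.toGraph.underlying.Reachable u (Sum.inl x) := by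
    rintro (x | x)
    · exact ⟨x, SimpleGraph.Reachable.refl _⟩
    · exact ⟨x, (h0 x).symm⟩
  exact
    { preconnected := fun u v => by
        obtain ⟨x, hx⟩ := h3 u
        obtain ⟨y, hy⟩ := h3 v
        exact (hx.trans (h2 x y)).trans hy.symm
      nonempty := inferInstance }

theorem HasEdges.isGluing_toGraph {D : Type} [Finite D] [Nonempty D] {m : ColoredMap d D}
    (hc : Function.Injective c) (hne : ∀ i, (c i).Nonempty) (hadm : ∀ i, Admissible (c i))
    (h : HasEdges c n m) : IsGluing c n m.toGraph := by
  obtain ⟨e, he, he'⟩ := h.exists_equiv hc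
  refine ⟨m.toGraph_connected (fun x => ?_) (fun x => ?_) h.1, ⟨⟨e, e, fun a w => ?_⟩⟩⟩
  · obtain ⟨i, hi⟩ := h.2.1 x
    exact hi ▸ hne i
  · obtain ⟨i, hi⟩ := h.2.1 x
    exact hi ▸ hadm i
  · change e (if a ∈ m.col w then m.inv w else w) =
      ⟨(e w).1, (if a ∈ c (e w).1.1 then Equiv.boolNot else Equiv.refl Bool) (e w).2⟩
    rw [he]
    split_ifs
    · exact he' w
    · rfl

theorem nonempty_fin_size (hn : ∃ i, n i ≠ 0) : Nonempty (Fin (size n)) := by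
  obtain ⟨i, hi⟩ := hn
  have := Finset.single_le_sum (f := n) (fun _ _ => Nat.zero_le _) (Finset.mem_univ i)
  exact ⟨⟨0, by unfold size; omega⟩⟩

section Bijective

variable (hc : Function.Injective c) (hne : ∀ i, (c i).Nonempty) (hadm : ∀ i, Admissible (c i))

/-- An isomorphism between the maps of two gluings extends from the white vertices to the black
ones by means of the pairings. -/
theorem J_injective : Function.Injective (J (n := n) hc hne hadm) := by
  intro G G' h
  induction G using Quotient.ind with | _ g
  induction G' using Quotient.ind with | _ g'
  obtain ⟨ψ, hψ⟩ : ∃ ψ : (g.toMap hc hne hadm).map.Iso (g'.toMap hc hne hadm).map,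
      ψ.dart g.root = g'.root := Quotient.exact h
  let P := (nonempty_pairing hne hadm g.isGluing).some
  let P' := (nonempty_pairing hne hadm g'.isGluing).some
  have hrot : ∀ x, ψ.dart ((g.graph.edge 0).symm (P.partner x)) =
      (g'.graph.edge 0).symm (P'.partner (ψ.dart x)) := ψ.rot
  have hinv : ∀ x, ψ.dart (P.opp x) = P'.opp (ψ.dart x) := ψ.inv
  have hcol : ∀ x, P'.col (ψ.dart x) = P.col x := ψ.col
  refine Quotient.sound ⟨⟨ψ.dart, P.partner.symm.trans (ψ.dart.trans P'.partner),
    fun a w => ?_⟩, hψ⟩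
  refine Fin.cases ?_ (fun a => ?_) a
  · have h1 := hrot (P.partner.symm (g.graph.edge 0 w))
    rw [Equiv.apply_symm_apply, Equiv.symm_apply_apply, Equiv.eq_symm_apply] at h1
    exact h1.symm
  · rw [P.edge_eq, P'.edge_eq, hcol]
    simp only [Equiv.trans_apply, Equiv.symm_apply_apply]
    split_ifs
    · rw [hinv]
    · rfl

theorem J_surjective (hn : ∃ i, n i ≠ 0) : Function.Surjective (J (n := n) hc hne hadm) := by
  intro M
  induction M using Quotient.ind with | _ m
  have := nonempty_fin_size hn
  let g : LabeledGluing c n :=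
    { graph := m.map.toGraph
      root := m.root
      isGluing := m.hasEdges.isGluing_toGraph hc hne hadm }
  have h1 : ∀ x, (m.map.col x).Nonempty := fun x => by
    obtain ⟨i, hi⟩ := m.hasEdges.2.1 x
    exact hi ▸ hne i
  have h2 : ∀ x, Admissible (m.map.col x) := fun x => by
    obtain ⟨i, hi⟩ := m.hasEdges.2.1 x
    exact hi ▸ hadm i
  let P := (nonempty_pairing hne hadm g.isGluing).some
  let Q : Pairing g.graph := m.map.pairing h1 h2
  refine ⟨Quotient.mk _ g, Quotient.sound ⟨⟨Equiv.refl _, fun x => ?_, fun x => ?_, fun x => ?_⟩,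
    rfl⟩⟩
  · change m.map.rot (P.partner x) = m.map.rot x
    rw [P.partner_unique Q]
    rfl
  · exact P.opp_unique Q x
  · exact (P.col_unique Q x).symm

theorem bicoloredCycles_eq_faces (G : Gluing c n) (a : Fin d) :
    G.bicoloredCycles a = (J hc hne hadm G).faces a := by
  induction G using Quotient.ind with | _ g
  let P := (nonempty_pairing hne hadm g.isGluing).some
  change numCycles _ = numCycles (P.toMap.rot * P.toMap.cross a)
  congr 1
  ext x
  change ((g.graph.edge 0).symm (g.graph.edge a.succ x)).val =
    ((g.graph.edge 0).symm (P.partner (if a ∈ P.col x then P.opp x else x))).val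
  rw [P.edge_eq]

end Bijective

/-! ### The maximum -/

theorem HasEdges.gap_univ {D : Type} [DecidableEq D] [Fintype D] [Nonempty D] {m : ColoredMap d D}
    (hc : Function.Injective c) (h : HasEdges c n m) :
    m.gap Finset.univ =
      2 * (((d + ∑ i, (d - (c i).card) * n i : ℕ) : ℤ) - ((∑ a, m.faces a : ℕ) : ℤ)) := by
  classical
  have h1 : Nat.card (Quotient (m.conn Set.univ ((Finset.univ : Finset D) : Set D))) = 1 := by
    rw [Finset.coe_univ]
    exact h.1.card_quotient
  choose idx hidx using h.2.1
  have h2 : ∑ x, ((d : ℤ) - (m.col x).card) = ∑ i, 2 * (((d - (c i).card) * n i : ℕ) : ℤ) := by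
    rw [← Finset.sum_fiberwise (g := idx)]
    refine Finset.sum_congr rfl fun i _ => ?_
    have h3 : (Finset.univ.filter fun x => idx x = i).card = 2 * n i := by
      rw [← h.2.2 i, ← Fintype.card_subtype, ← Nat.card_eq_fintype_card]
      refine Nat.card_congr (Equiv.subtypeEquivRight fun x => ?_)
      rw [hidx]
      exact hc.eq_iff.symm
    have h4 : ∀ x ∈ Finset.univ.filter fun x => idx x = i,
        ((d : ℤ) - (m.col x).card) = d - (c i).card := by
      intro x hx
      rw [hidx x, (Finset.mem_filter.1 hx).2]
    have h5 : (c i).card ≤ d := by simpa using (c i).card_le_univ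
    rw [Finset.sum_congr rfl h4, Finset.sum_const, h3]
    push_cast [h5]
    ring
  have h6 : ∀ a, numCycles (m.face (m.withColor Finset.univ a)) = m.faces a := fun a => by
    rw [m.face_withColor_univ]
    rfl
  rw [ColoredMap.gap, h1, h2, ← Finset.mul_sum]
  simp only [h6]
  push_cast
  ring

/-- The star with the given edges: the half-edges on one side are put around one vertex, and the
other ends of the edges become leaves. All its edges are bridges. -/
theorem exists_star {D : Type} [DecidableEq D] [Fintype D] (inv : Equiv.Perm D)
    (col : D → Finset (Fin d)) (inv_inv : ∀ x, inv (inv x) = x) (inv_ne : ∀ x, inv x ≠ x)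
    (col_inv : ∀ x, col (inv x) = col x) (side : D → Bool) (hside : ∀ x, side (inv x) = !side x) :
    ∃ m : ColoredMap d D, m.col = col ∧ m.Connected ∧ m.gap Finset.univ = 0 := by
  obtain ⟨f, hf, hsupp⟩ := (Finset.univ.filter fun x => side x = true).exists_cycleOn
  let m : ColoredMap d D := ⟨f, inv, col, inv_inv, inv_ne, col_inv⟩
  have hleaf : ∀ x, side x = false → f x = x := by
    intro x hx
    by_contra h
    have := hsupp (Equiv.Perm.mem_support.2 h)
    simp [hx] at this
  refine ⟨m, rfl, ?_, ?_⟩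
  · rw [m.connected_iff]
    have h1 : ∀ x y, side x = true → side y = true → m.conn Set.univ Set.univ x y :=
      fun x y hx hy => m.conn_univ_of_sameCycle _ (hf.2 (by simpa using hx) (by simpa using hy))
    have h2 : ∀ x, ∃ y, side y = true ∧ m.conn Set.univ Set.univ x y := by
      intro x
      cases hx : side x
      · exact ⟨inv x, by rw [hside, hx]; rfl, m.conn_inv _ trivial⟩
      · exact ⟨x, hx, Setoid.refl' _ _⟩
    intro x y
    obtain ⟨x', hx', hxx'⟩ := h2 x
    obtain ⟨y', hy', hyy'⟩ := h2 y
    exact Setoid.trans' _ hxx' (Setoid.trans' _ (h1 _ _ hx' hy') (Setoid.symm' _ hyy'))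
  · refine m.invClosed_empty.induction (P := fun S => m.gap S = 0) m.invClosed_univ
      (Finset.empty_subset _) m.gap_empty ?_
    intro S x _ _ hS _ hxS ih
    -- The leaf of the edge of `x` is isolated without this edge.
    have hisol : ∀ l y, side l = false → l ∉ S → m.conn Set.univ S l y → y = l := by
      intro l y hl hlS h
      have hle : m.conn Set.univ S ≤ Setoid.comap (fun z => z = l) ⊥ := by
        refine ColoredMap.conn_le.2 ⟨fun z _ => propext ?_, fun z hz => propext ?_⟩
        · constructor
          · rintro rfl
            exact hleaf _ hl
          · intro h
            exact f.injective (h.trans (hleaf l hl).symm)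
        · refine iff_of_false ?_ ?_
          · rintro rfl
            exact hlS hz
          · intro h
            exact hlS (h ▸ hS z hz)
      have h' : (l = l) = (y = l) := hle h
      exact h' ▸ rfl
    rw [ColoredMap.gap_addEdge_of_not_conn hS hxS, ih]
    intro h
    cases hx : side x
    · exact inv_ne x (hisol x _ hx hxS h)
    · have h1 : side (inv x) = false := by rw [hside, hx]; rfl
      exact inv_ne x (hisol _ _ h1 (hS.inv_notMem hxS) (Setoid.symm' _ h)).symm

theorem exists_labeledMap_gap_eq_zero (hc : Function.Injective c) (hn : ∃ i, n i ≠ 0) :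
    ∃ M : LabeledMap c n, M.map.gap Finset.univ = 0 := by
  have hcard : Fintype.card (Fin (size n)) = Fintype.card (Σ i, Fin (n i) × Bool) := by
    simp [size, Finset.sum_mul, mul_comm]
  let e := Fintype.equivOfCardEq hcard
  let flip : Equiv.Perm (Σ i, Fin (n i) × Bool) :=
    Function.Involutive.toPerm (fun q => ⟨q.1, q.2.1, !q.2.2⟩) fun q => by simp
  have hflip : ∀ x, e ((e.trans (flip.trans e.symm)) x) = ⟨(e x).1, (e x).2.1, !(e x).2.2⟩ :=
    fun x => e.apply_symm_apply _
  obtain ⟨m, hcol, hconn, hgap⟩ := exists_star (e.trans (flip.trans e.symm))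
    (fun x => c (e x).1) (fun x => e.injective (by rw [hflip, hflip]; simp))
    (fun x hx => by
      have h := congrArg e hx
      rw [hflip] at h
      exact Bool.not_ne_self _ (congrArg (fun q => q.2.2) h))
    (fun x => by rw [hflip]) (fun x => (e x).2.2) (fun x => by rw [hflip])
  refine ⟨⟨m, (nonempty_fin_size hn).some, hconn, fun x => ⟨(e x).1, by rw [hcol]⟩, fun i => ?_⟩,
    hgap⟩
  rw [hcol]
  have e' : {x // c (e x).1 = c i} ≃ {q : Σ i, Fin (n i) × Bool // q.1 = i} :=
    e.subtypeEquiv fun x => hc.eq_iff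
  rw [Nat.card_congr (e'.trans (Equiv.sigmaSubtype i))]
  simp [mul_comm]

/-- The gap of a map measures by how much its total number of faces is smaller than the bound. -/
theorem LabeledMap.sum_faces_le (hc : Function.Injective c) (hadm : ∀ i, Admissible (c i))
    (hn : ∃ i, n i ≠ 0) (m : LabeledMap c n) :
    ∑ a, m.map.faces a ≤ d + ∑ i, (d - (c i).card) * n i ∧
      (∑ a, m.map.faces a = d + ∑ i, (d - (c i).card) * n i ↔ m.map.gap Finset.univ = 0) := by
  have := nonempty_fin_size hn
  have h1 := m.hasEdges.gap_univ hc
  have h2 : 0 ≤ m.map.gap Finset.univ := by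
    refine ColoredMap.gap_nonneg (fun x => ?_) m.map.invClosed_univ
    obtain ⟨i, hi⟩ := m.hasEdges.2.1 x
    rw [hi]
    exact (hadm i).two_mul_card_le
  omega

end QuarticGluing

theorem mainTheorem9 {d N : ℕ} (c : Fin N → Finset (Fin d)) (n : Fin N → ℕ)
    (hc : Function.Injective c) (hne : ∀ i, (c i).Nonempty)
    (hadm : ∀ i, QuarticGluing.Admissible (c i)) (hn : ∃ i, n i ≠ 0) :
    -- `J` is a bijection that sends bicolored cycles with colors `0, a` to faces of the submap
    -- of the edges whose color sets contain `a`
    Function.Bijective (QuarticGluing.J (n := n) hc hne hadm) ∧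
    (∀ (G : QuarticGluing.Gluing c n) (a : Fin d),
      G.bicoloredCycles a = (QuarticGluing.J hc hne hadm G).faces a) ∧
    -- linear growth: the maximal number of bicolored cycles
    IsGreatest (Set.range fun G : QuarticGluing.Gluing c n => G.C₀)
      (d + ∑ i, (d - (c i).card) * n i) ∧
    -- the images of the maximizers are the maps with the maximal total number of faces
    QuarticGluing.J hc hne hadm '' QuarticGluing.Gluing.maximizers c n =
      {M : QuarticGluing.EdgeColoredMap c n |
        ∀ M' : QuarticGluing.EdgeColoredMap c n, ∑ a, M'.faces a ≤ ∑ a, M.faces a} ∧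
    -- and they are characterized by the three conditions
    ∀ m : QuarticGluing.LabeledMap c n,
      (Quotient.mk (QuarticGluing.mapSetoid c n) m ∈
          QuarticGluing.J hc hne hadm '' QuarticGluing.Gluing.maximizers c n ↔
        m.map.Planar ∧
        (∀ x, 2 * (m.map.col x).card < d → m.map.IsBridge x) ∧
        ∀ i j, i ≠ j → m.map.MeetOnlyAtCutVertices (c i) (c j)) := by
  have hsurj := QuarticGluing.J_surjective (n := n) hc hne hadm hn
  have hfaces := QuarticGluing.bicoloredCycles_eq_faces (n := n) hc hne hadm
  have hC₀ : ∀ G : QuarticGluing.Gluing c n,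
      G.C₀ = ∑ a, (QuarticGluing.J hc hne hadm G).faces a :=
    fun G => Finset.sum_congr rfl fun a _ => hfaces G a
  have hle : ∀ M : QuarticGluing.EdgeColoredMap c n,
      ∑ a, M.faces a ≤ d + ∑ i, (d - (c i).card) * n i := by
    intro M
    induction M using Quotient.ind with | _ m
    exact (m.sum_faces_le hc hadm hn).1
  obtain ⟨M₀, hM₀⟩ : ∃ M : QuarticGluing.EdgeColoredMap c n,
      ∑ a, M.faces a = d + ∑ i, (d - (c i).card) * n i := by
    obtain ⟨m, hm⟩ := QuarticGluing.exists_labeledMap_gap_eq_zero hc hn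
    exact ⟨Quotient.mk _ m, (m.sum_faces_le hc hadm hn).2.2 hm⟩
  have himage : QuarticGluing.J hc hne hadm '' QuarticGluing.Gluing.maximizers c n =
      {M : QuarticGluing.EdgeColoredMap c n |
        ∀ M' : QuarticGluing.EdgeColoredMap c n, ∑ a, M'.faces a ≤ ∑ a, M.faces a} := by
    ext M
    constructor
    · rintro ⟨G, hG, rfl⟩ M'
      obtain ⟨G', rfl⟩ := hsurj M'
      rw [← hC₀, ← hC₀]
      exact hG G'
    · intro hM
      obtain ⟨G, rfl⟩ := hsurj M
      refine ⟨G, fun G' => ?_, rfl⟩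
      rw [hC₀, hC₀]
      exact hM _
  refine ⟨⟨QuarticGluing.J_injective hc hne hadm, hsurj⟩, hfaces, ⟨?_, ?_⟩, himage, fun m => ?_⟩
  · obtain ⟨G₀, rfl⟩ := hsurj M₀
    exact ⟨G₀, (hC₀ G₀).trans hM₀⟩
  · rintro _ ⟨G, rfl⟩
    exact (hC₀ G).trans_le (hle _)
  · have := QuarticGluing.nonempty_fin_size hn
    have hadm' : ∀ x, QuarticGluing.Admissible (m.map.col x) := fun x => by
      obtain ⟨i, hi⟩ := m.hasEdges.2.1 x
      exact hi ▸ hadm i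
    have hmax : (∀ M' : QuarticGluing.EdgeColoredMap c n,
        ∑ a, M'.faces a ≤ ∑ a, m.map.faces a) ↔ m.map.gap Finset.univ = 0 := by
      rw [← (m.sum_faces_le hc hadm hn).2]
      exact ⟨fun h => le_antisymm (m.sum_faces_le hc hadm hn).1 (hM₀ ▸ h M₀),
        fun h M' => h ▸ hle M'⟩
    rw [himage]
    refine hmax.trans ((QuarticGluing.ColoredMap.gap_eq_zero_iff hadm' m.hasEdges.1).trans
      (and_congr_right fun _ => and_congr_right fun _ => ⟨?_, ?_⟩))
    · intro h i j hij x y hx hy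
      exact h x y (by rw [hx, hy]; exact hc.ne hij)
    · intro h x y hne' hxy
      obtain ⟨i, hi⟩ := m.hasEdges.2.1 x
      obtain ⟨j, hj⟩ := m.hasEdges.2.1 y
      exact h i j (fun hij => hne' (by rw [hi, hj, hij])) x y hi hj hxy
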